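/- Let $T>0$, $\hat V>\check V>0$ and $\check\rho\in\,]0,1[$. Let $\rho_o\in L^\infty(\mathbb R;[0,1])$ have finite total variation and let $p\in W^{1,\infty}([0,T];\mathbb R)$ (i.e. $p$ is Lipschitz continuous) be such that $$\operatorname*{ess\,inf}_{x\in\mathbb R}\rho_o>\check\rho,\qquad \operatorname*{ess\,inf}_{t\in[0,T]}\dot p\ \ge\ \hat V(1-2\check\rho),\qquad \operatorname*{ess\,inf}_{t\in[0,T]}\dot p\ \ge\ \check V(1-2\check\rho).$$ (The third condition follows from the second if $\check\rho\le 1/2$, and it holds if $\check\rho\ge 1/2$ and $\dot p\ge0$ a.e.) For $V\in[\check V,\hat V]$ put $v_V(\rho)=V(1-\rho)$ and $f_V(\rho)=\rho\,v_V(\rho)$, and let $\rho_V\in L^\infty(\mathbb R^+\times\mathbb R;[0,1])$ be the Kružkov solution of $\partial_t\rho+\partial_x f_V(\rho)=0$, $\rho(0,\cdot)=\rho_o$, that is, $$\int_0^\infty\!\!\int_{\mathbb R}\Big[|\rho_V-k|\,\partial_t\varphi+\operatorname{sgn}(\rho_V-k)\,\big(f_V(\rho_V)-f_V(k)\big)\,\partial_x\varphi\Big]\,dx\,dt\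 \ge\ 0$$ for all $k\in\mathbb R$ and all $\varphi\in C_c^\infty(]0,\infty[\times\mathbb R;[0,\infty[)$, and $\int_{\mathbb R}|\rho_V(t,x)-\rho_o(x)|\,dx\to0$ as $t\to0+$ outside a set of times of measure zero. Then, for every $V\in[\check V,\hat V]$ and for a.e. $t\in[0,T]$, the (two-sided) essential limit of $x\mapsto\rho_V(t,x)$ at $x=p(t)$ exists; denote it by $\rho_V(t,p(t))$. The function $t\mapsto|\dot p(t)-v_V(\rho_V(t,p(t)))|$ is integrable on $[0,T]$, and the map $$\mathcal E\colon[\check V,\hat V]\to\mathbb R,\qquad \mathcal E(V)=\int_0^T\big|\dot p(t)-v_V\big(\rho_V(t,p(t))\big)\big|\,dt$$ is continuous. In particular $\mathcal E$ attains its minimum on $[\check V,\hat V]$, i.e. the inverse problem of finding the speed law $v_V$, $V\in[\check V,\hat V]$, that minimizes the error has a solution. -/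

import Mathlib

open MeasureTheory Filter Topology Set
open scoped ContDiff

/-- The speed law `v_V(r) = V (1 - r)`. -/
def lwrSpeed (V r : ℝ) : ℝ := V * (1 - r)

/-- The flux `r v_V(r)` of the LWR model. -/
def lwrFlux (V r : ℝ) : ℝ := r * lwrSpeed V r

/-- The `L^∞` class of `u` belongs to `BV(ℝ)` up to integrability, i.e. `u` has finite (essential)
total variation: some representative of `u` has bounded pointwise variation on `ℝ`. -/
def HasFiniteTV (u : ℝ → ℝ) : Prop :=
  ∃ g : ℝ → ℝ, u =ᵐ[volume] g ∧ BoundedVariationOn g univ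

/-- `φ ∈ C_c^∞(]0,∞[ × ℝ; [0,∞[)`, the first variable being time. -/
structure IsNonnegTest (φ : ℝ × ℝ → ℝ) : Prop where
  smooth : ContDiff ℝ ∞ φ
  compact : HasCompactSupport φ
  support : tsupport φ ⊆ Ioi 0 ×ˢ univ
  nonneg : ∀ z, 0 ≤ φ z

/-- `ρ ∈ L^∞(ℝ⁺ × ℝ; [0,1])` is a Kružkov (entropy) solution of
`∂ₜ ρ + ∂ₓ f(ρ) = 0`, `ρ(0, ·) = ρo`.  -/
structure IsKruzkovSolution (f : ℝ → ℝ) (ρo : ℝ → ℝ) (ρ : ℝ → ℝ → ℝ) : Prop where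
  measurable : AEMeasurable (fun z : ℝ × ℝ => ρ z.1 z.2)
    (volume.restrict (Ioi (0 : ℝ) ×ˢ (univ : Set ℝ)))
  range : ∀ᵐ z ∂(volume.restrict (Ioi (0 : ℝ) ×ˢ (univ : Set ℝ))), ρ z.1 z.2 ∈ Icc (0 : ℝ) 1
  entropy : ∀ (k : ℝ) (φ : ℝ × ℝ → ℝ), IsNonnegTest φ →
    0 ≤ ∫ z in Ioi (0 : ℝ) ×ˢ (univ : Set ℝ),
      (|ρ z.1 z.2 - k| * fderiv ℝ φ z (1, 0)
        + Real.sign (ρ z.1 z.2 - k) * (f (ρ z.1 z.2) - f k) * fderiv ℝ φ z (0, 1))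
  initial : ∃ N : Set ℝ, volume N = 0 ∧
    Tendsto (fun t => ∫⁻ x, ENNReal.ofReal |ρ t x - ρo x|) (𝓝[Ioi 0 \ N] 0) (𝓝 0)

/-- The trace `u(x+)`: the essential limit of `u` at `x` from the right. It depends only on the
almost-everywhere class of `u`; the value is junk if the limit does not exist. -/
noncomputable def rightTrace (u : ℝ → ℝ) (x : ℝ) : ℝ :=
  limUnder (𝓝[>] x ⊓ ae volume) u

/-- The pointwise error `|ṗ(t) - v_V(ρ(t, p(t)+))|`. -/
noncomputable def speedError (p : ℝ → ℝ) (V : ℝ) (ρ : ℝ → ℝ → ℝ) (t : ℝ) : ℝ :=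
  |deriv p t - lwrSpeed V (rightTrace (ρ t) (p t))|

/-- The error functional `∫₀ᵀ |ṗ(t) - v_V(ρ(t, p(t)+))| dt`. -/
noncomputable def errorFunctional (T : ℝ) (p : ℝ → ℝ) (V : ℝ) (ρ : ℝ → ℝ → ℝ) : ℝ :=
  ∫ t in (0 : ℝ)..T, speedError p V ρ t

/-! The flux `f_V` is linear in `V`, so changing the speed amounts to dilating time: uniqueness
identifies the solution for `W` with `(t, x) ↦ ρ_V (W t / V, x)`. Continuity of the error therefore
concerns the single function `ρ_V`, its traces along the path, and dilation factors tending to `1`.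

The trace exists because the path outruns the waves. By comparison the solution stays above `k = ess
inf ρo > ř`, and above `k` all chord speeds of the concave flux are at most `V (1 - 2 k)`, which is
smaller than `ess inf ṗ` by a margin `δ > 0` uniform in `V`. Kato's inequality for the solution and
its translate by `h`, tested with a smooth step of width `ε` that follows the path, bounds the
space-time integral of `|ρ (t, x + h) - ρ (t, x)|` over an `ε`-strip around the path by a multiple
of `ε h TV(ρo) / δ`. Dividing by `h` bounds the time integral of the local oscillation by `O(ε)`;
hence for a.e. `t` the oscillation around `p t` becomes arbitrarily small, and a two-sided essential
limit exists (`IsEntropyFunction.ae_exists_tendsto`).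

Two-sidedness gives continuity. In the variable `s = c t` the dilated trace is the trace of the same
slice `ρ_V (s, ·)` at the nearby point `p (s / c)`. Essential limits at nearby points converge to
the one at `p s`, so dominated convergence and the `L¹`-continuity of dilations yield convergence of
the traces (`tendsto_lintegral_essLimit_sub`), hence of the error. The minimum exists by
compactness.

Both the `L¹` estimates and uniqueness come from doubling of variables (`IsEntropyFunction.kato`)
followed by weighted energy estimates for an abstract dissipated density and flux
(`IsDissipativePair`). -/

/-- `L¹`-continuity of composition with maps that converge pointwise to the identity. -/
theorem tendsto_setLIntegral_comp_sub {X ι : Type*} [TopologicalSpace X] [NormalSpace X]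
    [R1Space X] [WeaklyLocallyCompactSpace X] [MeasurableSpace X] [BorelSpace X]
    {μ : Measure X} [μ.Regular] {l : Filter ι} [l.IsCountablyGenerated]
    {f : X → ℝ} (hf : Integrable f μ) (hfm : Measurable f) {S : Set X} (hS : μ S ≠ ⊤)
    {T : ι → X → X} (hT : ∀ᶠ i in l, Measurable (T i)) (hlim : ∀ x, Tendsto (T · x) l (𝓝 x))
    {C : ENNReal} (hC : C ≠ ⊤) (hmap : ∀ᶠ i in l, μ.map (T i) ≤ C • μ) :
    Tendsto (fun i => ∫⁻ x in S, ‖f (T i x) - f x‖ₑ ∂μ) l (𝓝 0) := by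
  rw [ENNReal.tendsto_nhds_zero]
  intro ε hε
  -- Replacing `f` by a continuous `g` costs `ε'` for `f - g` and, through the pushforward bound, `C
  -- * ε'` for its composition with `T i`.
  obtain ⟨ε', hε'0, hε'⟩ : ∃ ε' : ENNReal, ε' ≠ 0 ∧ (C + 1) * ε' ≤ ε / 2 := by
    refine ⟨(ε / 2) / (C + 1), ?_, ENNReal.mul_div_le⟩
    simp [ENNReal.div_eq_zero_iff, hε.ne', hC]
  obtain ⟨g, hgc, hfg, hg, -⟩ := hf.exists_hasCompactSupport_lintegral_sub_le hε'0
  obtain ⟨M, hM⟩ := hgc.exists_bound_of_continuous hg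
  have : IsFiniteMeasure (μ.restrict S) := ⟨by simpa using hS.lt_top⟩
  have hmid : Tendsto (fun i => ∫⁻ x in S, ‖g (T i x) - g x‖ₑ ∂μ) l (𝓝 0) := by
    have := tendsto_lintegral_filter_of_dominated_convergence (μ := μ.restrict S) (l := l)
      (F := fun i x => ‖g (T i x) - g x‖ₑ) (f := fun _ => 0) (fun _ => ENNReal.ofReal (M + M))
      (by
        filter_upwards [hT] with i hi
        exact ((hg.measurable.comp hi).sub hg.measurable).enorm)
      (by
        refine Eventually.of_forall fun i => Eventually.of_forall fun x => ?_
        rw [← ofReal_norm]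
        exact ENNReal.ofReal_le_ofReal ((norm_sub_le _ _).trans (add_le_add (hM _) (hM _))))
      (by simpa using ENNReal.mul_ne_top ENNReal.ofReal_ne_top hS)
      (by
        refine Eventually.of_forall fun x => ?_
        have h1 : Tendsto (fun i => g (T i x) - g x) l (𝓝 (g x - g x)) :=
          ((hg.tendsto x).comp (hlim x)).sub_const _
        simpa using h1.enorm)
    simpa using this
  rw [ENNReal.tendsto_nhds_zero] at hmid
  filter_upwards [hT, hmap, hmid (ε / 2) (ENNReal.half_pos hε.ne')] with i hi hmi hsmall
  have hmeas : Measurable fun x => ‖f x - g x‖ₑ := (hfm.sub hg.measurable).enorm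
  calc ∫⁻ x in S, ‖f (T i x) - f x‖ₑ ∂μ
      ≤ ∫⁻ x in S, (‖f (T i x) - g (T i x)‖ₑ + ‖g (T i x) - g x‖ₑ) + ‖f x - g x‖ₑ ∂μ := by
        refine lintegral_mono fun x => ?_
        have : f (T i x) - f x
            = ((f (T i x) - g (T i x)) + (g (T i x) - g x)) - (f x - g x) := by ring
        rw [this]
        exact enorm_sub_le.trans (by gcongr; exact enorm_add_le _ _)
    _ = (∫⁻ x in S, ‖f (T i x) - g (T i x)‖ₑ ∂μ + ∫⁻ x in S, ‖g (T i x) - g x‖ₑ ∂μ)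
          + ∫⁻ x in S, ‖f x - g x‖ₑ ∂μ := by
        rw [lintegral_add_right _ hmeas, lintegral_add_left]
        exact hmeas.comp hi
    _ ≤ (C * ε' + ε / 2) + ε' := by
        gcongr
        · calc ∫⁻ x in S, ‖f (T i x) - g (T i x)‖ₑ ∂μ
              ≤ ∫⁻ x, ‖f (T i x) - g (T i x)‖ₑ ∂μ := setLIntegral_le_lintegral _ _
            _ = ∫⁻ x, ‖f x - g x‖ₑ ∂(μ.map (T i)) := (lintegral_map hmeas hi).symm
            _ ≤ ∫⁻ x, ‖f x - g x‖ₑ ∂(C • μ) := lintegral_mono' hmi le_rfl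
            _ = C * ∫⁻ x, ‖f x - g x‖ₑ ∂μ := by rw [lintegral_smul_measure, smul_eq_mul]
            _ ≤ C * ε' := by gcongr
        · exact (setLIntegral_le_lintegral _ _).trans hfg
    _ = (C + 1) * ε' + ε / 2 := by ring
    _ ≤ ε / 2 + ε / 2 := by gcongr
    _ = ε := ENNReal.add_halves ε

/-! ### Entropy flux and the Kato inequality -/

/-- The Kružkov entropy flux `sgn (a - b) (f_V(a) - f_V(b))` of the LWR flux. -/
def entropyFlux (V a b : ℝ) : ℝ := |a - b| * (V * (1 - a - b))

theorem entropyFlux_comm (V a b : ℝ) : entropyFlux V a b = entropyFlux V b a := by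
  rw [entropyFlux, entropyFlux, abs_sub_comm]; ring

/-- The flux is quadratic, with chord slope `V * (1 - a - b)` between `a` and `b`; factoring it out
leaves only an absolute value. -/
theorem sign_mul_lwrFlux_sub (V a b : ℝ) :
    Real.sign (a - b) * (lwrFlux V a - lwrFlux V b) = entropyFlux V a b := by
  have h : Real.sign (a - b) * (a - b) = |a - b| := by
    rcases lt_trichotomy (a - b) 0 with h | h | h
    · rw [Real.sign_of_neg h, abs_of_neg h]; ring
    · rw [h]; simp
    · rw [Real.sign_of_pos h, abs_of_pos h]; ring
  rw [entropyFlux, ← h, lwrFlux, lwrFlux, lwrSpeed, lwrSpeed]; ring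

theorem abs_entropyFlux_le {V a b : ℝ} (hV : 0 ≤ V) (ha : a ∈ Icc (0 : ℝ) 1)
    (hb : b ∈ Icc (0 : ℝ) 1) : |entropyFlux V a b| ≤ V * |a - b| := by
  rw [entropyFlux, abs_mul, abs_abs, abs_mul, abs_of_nonneg hV, mul_comm]
  have : |1 - a - b| ≤ 1 := by rw [abs_le]; constructor <;> linarith [ha.1, ha.2, hb.1, hb.2]
  gcongr
  nlinarith

theorem abs_entropyFlux_sub_le {V a b c : ℝ} (hV : 0 ≤ V) (ha : a ∈ Icc (0 : ℝ) 1)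
    (hb : b ∈ Icc (0 : ℝ) 1) (hc : c ∈ Icc (0 : ℝ) 1) :
    |entropyFlux V a b - entropyFlux V a c| ≤ 2 * V * |b - c| := by
  have h1 : entropyFlux V a b - entropyFlux V a c
      = V * ((|a - b| - |a - c|) * (1 - a - b) + |a - c| * (c - b)) := by
    rw [entropyFlux, entropyFlux]; ring
  have h2 : |(|a - b| - |a - c|)| ≤ |b - c| := by
    have := abs_abs_sub_abs_le (a - b) (a - c)
    rwa [show a - b - (a - c) = c - b by ring, abs_sub_comm c b] at this
  have h3 : |1 - a - b| ≤ 1 := by rw [abs_le]; constructor <;> linarith [ha.1, ha.2, hb.1, hb.2]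
  have h4 : |a - c| ≤ 1 := by rw [abs_le]; constructor <;> linarith [ha.1, ha.2, hc.1, hc.2]
  rw [h1, abs_mul, abs_of_nonneg hV, mul_comm 2 V, mul_assoc]
  gcongr
  calc _ ≤ |(|a - b| - |a - c|) * (1 - a - b)| + |(|a - c| * (c - b))| := abs_add_le _ _
    _ = |(|a - b| - |a - c|)| * |1 - a - b| + |a - c| * |b - c| := by
      rw [abs_mul, abs_mul, abs_abs, abs_sub_comm c b]
    _ ≤ |b - c| * 1 + 1 * |b - c| := by gcongr
    _ = _ := by ring

/-- A measurable function on the plane with values in `[0,1]` that satisfies the Kružkov entropy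
inequalities of the LWR flux on `]0,∞[ × ℝ`. -/
structure IsEntropyFunction (V : ℝ) (r : ℝ × ℝ → ℝ) : Prop where
  measurable : Measurable r
  mem_Icc : ∀ z, r z ∈ Icc (0 : ℝ) 1
  entropy : ∀ (k : ℝ) (φ : ℝ × ℝ → ℝ), IsNonnegTest φ →
    0 ≤ ∫ z, (|r z - k| * fderiv ℝ φ z (1, 0) + entropyFlux V (r z) k * fderiv ℝ φ z (0, 1))

theorem IsNonnegTest.continuous_fderiv_apply {φ : ℝ × ℝ → ℝ} (hφ : IsNonnegTest φ) (v : ℝ × ℝ) :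
    Continuous fun z => fderiv ℝ φ z v :=
  (hφ.smooth.continuous_fderiv (by simp)).clm_apply continuous_const

theorem IsNonnegTest.hasCompactSupport_fderiv_apply {φ : ℝ × ℝ → ℝ} (hφ : IsNonnegTest φ)
    (v : ℝ × ℝ) : HasCompactSupport fun z => fderiv ℝ φ z v :=
  hφ.compact.fderiv_apply (𝕜 := ℝ) v

/-- A product of a bounded measurable function with a continuous compactly supported function is
integrable. -/
theorem integrable_bdd_mul_of_hasCompactSupport {X : Type*} [TopologicalSpace X]
    [MeasurableSpace X] [BorelSpace X] {μ : Measure X} [IsFiniteMeasureOnCompacts μ]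
    {c g : X → ℝ} (hc : Measurable c) {M : ℝ} (hM : ∀ x, |c x| ≤ M) (hg : Continuous g)
    (hgc : HasCompactSupport g) : Integrable (fun x => c x * g x) μ :=
  (hg.integrable_of_hasCompactSupport hgc).bdd_mul hc.aestronglyMeasurable
    (Eventually.of_forall hM)

/-- The integral against the doubled test function. -/
noncomputable def katoIntegral (V : ℝ) (r s φ : ℝ × ℝ → ℝ) (u : ℝ × ℝ) : ℝ :=
  ∫ z, (|r z - s (z - u)| * fderiv ℝ φ z (1, 0)
    + entropyFlux V (r z) (s (z - u)) * fderiv ℝ φ z (0, 1))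

theorem abs_sub_le_one_of_mem_Icc {a b : ℝ} (ha : a ∈ Icc (0 : ℝ) 1) (hb : b ∈ Icc (0 : ℝ) 1) :
    |(|a - b|)| ≤ 1 := by
  rw [abs_abs, abs_le]; constructor <;> linarith [ha.1, ha.2, hb.1, hb.2]

theorem abs_entropyFlux_le_of_mem_Icc {V a b : ℝ} (hV : 0 ≤ V) (ha : a ∈ Icc (0 : ℝ) 1)
    (hb : b ∈ Icc (0 : ℝ) 1) : |entropyFlux V a b| ≤ V :=
  (abs_entropyFlux_le hV ha hb).trans <| by
    have := abs_sub_le_one_of_mem_Icc ha hb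
    rw [abs_abs] at this
    nlinarith

theorem measurable_entropyFlux {X : Type*} [MeasurableSpace X] (V : ℝ) {a b : X → ℝ}
    (ha : Measurable a) (hb : Measurable b) : Measurable fun x => entropyFlux V (a x) (b x) := by
  unfold entropyFlux; fun_prop

theorem hasCompactSupport_mul_comp_sub {φ η : ℝ × ℝ → ℝ}
    (hφ : HasCompactSupport φ) (hη : HasCompactSupport η) :
    HasCompactSupport fun q : (ℝ × ℝ) × (ℝ × ℝ) => φ q.1 * η (q.1 - q.2) := by
  refine HasCompactSupport.intro
    ((hφ.isCompact.prod hη.isCompact).image (f := fun q => (q.1, q.1 - q.2)) (by fun_prop)) ?_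
  rintro ⟨z, w⟩ hq
  by_contra h
  refine hq ⟨(z, z - w), ⟨?_, ?_⟩, by simp⟩
  · exact subset_tsupport _ (left_ne_zero_of_mul h)
  · exact subset_tsupport _ (right_ne_zero_of_mul h)

theorem hasCompactSupport_mul_prod {φ η : ℝ × ℝ → ℝ}
    (hφ : HasCompactSupport φ) (hη : HasCompactSupport η) :
    HasCompactSupport fun q : (ℝ × ℝ) × (ℝ × ℝ) => φ q.1 * η q.2 := by
  refine HasCompactSupport.intro (hφ.isCompact.prod hη.isCompact) ?_
  rintro ⟨z, w⟩ hq
  by_contra h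
  exact hq ⟨subset_tsupport _ (left_ne_zero_of_mul h), subset_tsupport _ (right_ne_zero_of_mul h)⟩

/-- Doubling of variables with the test function `φ z * η (z - w)`. The inequality for `r` is used
in `z` with constant `s w`, the one for `s` in `w` with constant `r z`. On adding them the
derivatives of `η` cancel, and `w = z - u` turns the rest into an average over shifts `u`. The
support condition keeps the `w`-test inside positive times. -/
theorem integrable_and_integral_mul_katoIntegral_nonneg {V : ℝ} (hV : 0 ≤ V) {r s : ℝ × ℝ → ℝ}
    (hr : IsEntropyFunction V r) (hs : IsEntropyFunction V s) {φ : ℝ × ℝ → ℝ}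
    (hφ : IsNonnegTest φ) {η : ℝ × ℝ → ℝ} (hη : ContDiff ℝ ∞ η) (hηc : HasCompactSupport η)
    (hη0 : ∀ u, 0 ≤ η u)
    (hsupp : ∀ z ∈ tsupport φ, ∀ u ∈ tsupport η, z - u ∈ Ioi (0 : ℝ) ×ˢ (univ : Set ℝ)) :
    Integrable (fun u => η u * katoIntegral V r s φ u) ∧
      0 ≤ ∫ u, η u * katoIntegral V r s φ u := by
  have hrm := hr.measurable
  have hsm := hs.measurable
  have hφd : Differentiable ℝ φ := hφ.smooth.differentiable (by simp)
  have hηd : Differentiable ℝ η := hη.differentiable (by simp)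
  have hφcont : Continuous φ := hφ.smooth.continuous
  have hηcont : Continuous η := hη.continuous
  have hφ' (v) := hφ.continuous_fderiv_apply v
  have hφc' (v) := hφ.hasCompactSupport_fderiv_apply v
  have hη' (v : ℝ × ℝ) : Continuous fun z => fderiv ℝ η z v :=
    (hη.continuous_fderiv (by simp)).clm_apply continuous_const
  have hηc' (v : ℝ × ℝ) : HasCompactSupport fun z => fderiv ℝ η z v :=
    hηc.fderiv_apply (𝕜 := ℝ) v
  -- integrability on the product of the four kinds of terms
  have hint (c : (ℝ × ℝ) × (ℝ × ℝ) → ℝ) (M : ℝ) (hc : Measurable c) (hM : ∀ q, |c q| ≤ M)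
      (α β : ℝ × ℝ → ℝ) (hα : Continuous α) (hβ : Continuous β) (hαc : HasCompactSupport α)
      (hβc : HasCompactSupport β) :
      Integrable (fun q : (ℝ × ℝ) × (ℝ × ℝ) => c q * (α q.1 * β (q.1 - q.2)))
        (volume.prod volume) :=
    integrable_bdd_mul_of_hasCompactSupport hc hM (by fun_prop)
      (hasCompactSupport_mul_comp_sub hαc hβc)
  have hint' (c : (ℝ × ℝ) × (ℝ × ℝ) → ℝ) (M : ℝ) (hc : Measurable c) (hM : ∀ q, |c q| ≤ M)
      (α β : ℝ × ℝ → ℝ) (hα : Continuous α) (hβ : Continuous β) (hαc : HasCompactSupport α)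
      (hβc : HasCompactSupport β) :
      Integrable (fun q : (ℝ × ℝ) × (ℝ × ℝ) => c q * (α q.1 * β q.2))
        (volume.prod volume) :=
    integrable_bdd_mul_of_hasCompactSupport hc hM (by fun_prop)
      (hasCompactSupport_mul_prod hαc hβc)
  let A : (ℝ × ℝ) × (ℝ × ℝ) → ℝ := fun q => |r q.1 - s q.2|
  let B : (ℝ × ℝ) × (ℝ × ℝ) → ℝ := fun q => entropyFlux V (r q.1) (s q.2)
  have hA : Measurable A := by fun_prop
  have hB : Measurable B := measurable_entropyFlux V (by fun_prop) (by fun_prop)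
  have hA1 (q) : |A q| ≤ 1 := abs_sub_le_one_of_mem_Icc (hr.mem_Icc _) (hs.mem_Icc _)
  have hB1 (q) : |B q| ≤ V := abs_entropyFlux_le_of_mem_Icc hV (hr.mem_Icc _) (hs.mem_Icc _)
  have iA1 := hint A 1 hA hA1 _ η (hφ' (1, 0)) hηcont (hφc' (1, 0)) hηc
  have iB1 := hint B V hB hB1 _ η (hφ' (0, 1)) hηcont (hφc' (0, 1)) hηc
  have iA2 := hint A 1 hA hA1 φ _ hφcont (hη' (1, 0)) hφ.compact (hηc' (1, 0))
  have iB2 := hint B V hB hB1 φ _ hφcont (hη' (0, 1)) hφ.compact (hηc' (0, 1))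
  -- `H` carries the derivatives of `φ`, `K` those of `η`: the inequality for `r` gives `H + K`, the
  -- one for `s` gives `-K`.
  let H : (ℝ × ℝ) × (ℝ × ℝ) → ℝ := fun q =>
    A q * (fderiv ℝ φ q.1 (1, 0) * η (q.1 - q.2)) + B q * (fderiv ℝ φ q.1 (0, 1) * η (q.1 - q.2))
  let K : (ℝ × ℝ) × (ℝ × ℝ) → ℝ := fun q =>
    A q * (φ q.1 * fderiv ℝ η (q.1 - q.2) (1, 0)) + B q * (φ q.1 * fderiv ℝ η (q.1 - q.2) (0, 1))
  have iH : Integrable H (volume.prod volume) := iA1.add iB1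
  have iK : Integrable K (volume.prod volume) := iA2.add iB2
  -- the inequality for `r`
  have h1 : 0 ≤ ∫ q, (H q + K q) ∂(volume.prod volume) := by
    rw [integral_prod_symm (fun q => H q + K q) (iH.add iK)]
    refine integral_nonneg fun w => ?_
    have htest : IsNonnegTest fun z => φ z * η (z - w) :=
      { smooth := hφ.smooth.mul (hη.comp (by fun_prop))
        compact := hφ.compact.mul_right
        support := (tsupport_mul_subset_left).trans hφ.support
        nonneg := fun z => mul_nonneg (hφ.nonneg z) (hη0 _) }
    have hfd (z v : ℝ × ℝ) : fderiv ℝ (fun z => φ z * η (z - w)) z v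
        = fderiv ℝ φ z v * η (z - w) + φ z * fderiv ℝ η (z - w) v := by
      have e : HasFDerivAt (fun z => η (z - w)) (fderiv ℝ η (z - w)) z := by
        have := ((hηd (z - w)).hasFDerivAt).comp z ((hasFDerivAt_id z).sub_const w)
        exact this.congr_fderiv (by ext <;> simp)
      rw [((hφd z).hasFDerivAt.fun_mul e).fderiv]
      simp; ring
    refine (hr.entropy (s w) _ htest).trans_eq (integral_congr_ae (Eventually.of_forall ?_))
    intro z
    simp only [hfd, H, K, A, B]
    ring
  -- the inequality for `s`
  have h2 : 0 ≤ ∫ q, (-K q) ∂(volume.prod volume) := by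
    rw [integral_prod (fun q => -K q) iK.neg]
    refine integral_nonneg fun z => ?_
    by_cases hz : z ∈ tsupport φ
    swap
    · have : φ z = 0 := image_eq_zero_of_notMem_tsupport hz
      simp [K, this]
    have htest : IsNonnegTest fun w => φ z * η (z - w) := by
      have hsub : tsupport (fun w => φ z * η (z - w)) ⊆ (fun w => z - w) ⁻¹' tsupport η := by
        refine closure_minimal (fun w hw => ?_) ((isClosed_tsupport η).preimage (by fun_prop))
        exact subset_tsupport _ (right_ne_zero_of_mul hw)
      refine ⟨contDiff_const.mul (hη.comp (by fun_prop)), ?_, ?_,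
        fun w => mul_nonneg (hφ.nonneg z) (hη0 _)⟩
      · refine HasCompactSupport.intro (hηc.isCompact.image (f := fun u => z - u) (by fun_prop))
          fun w hw => ?_
        by_contra h
        exact hw ⟨z - w, subset_tsupport _ (right_ne_zero_of_mul h), by simp⟩
      · intro w hw
        have := hsupp z hz _ (hsub hw)
        simpa using this
    have hfd (w v : ℝ × ℝ) : fderiv ℝ (fun w => φ z * η (z - w)) w v
        = -(φ z * fderiv ℝ η (z - w) v) := by
      have e : HasFDerivAt (fun w => η (z - w)) (-(fderiv ℝ η (z - w))) w := by
        have := ((hηd (z - w)).hasFDerivAt).comp w ((hasFDerivAt_id w).const_sub z)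
        exact this.congr_fderiv (by ext <;> simp)
      rw [(e.const_mul (φ z)).fderiv]
      simp
    refine (hs.entropy (r z) _ htest).trans_eq (integral_congr_ae (Eventually.of_forall ?_))
    intro w
    simp only [hfd, K, A, B]
    rw [abs_sub_comm (s w), entropyFlux_comm V (s w)]
    ring
  have h3 : 0 ≤ ∫ q, H q ∂(volume.prod volume) := by
    rw [integral_add iH iK] at h1
    rw [integral_neg] at h2
    linarith
  have iA3 := hint' (fun q => A (q.1, q.1 - q.2)) 1 (by fun_prop) (fun q => hA1 _) _ η
    (hφ' (1, 0)) hηcont (hφc' (1, 0)) hηc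
  have iB3 := hint' (fun q => B (q.1, q.1 - q.2)) V (by fun_prop) (fun q => hB1 _) _ η
    (hφ' (0, 1)) hηcont (hφc' (0, 1)) hηc
  have iH3 : Integrable (fun q : (ℝ × ℝ) × (ℝ × ℝ) => H (q.1, q.1 - q.2))
      (volume.prod volume) := by
    refine (iA3.add iB3).congr (Eventually.of_forall fun q => ?_)
    simp [H]
  rw [integral_prod _ iH] at h3
  have h4 (z : ℝ × ℝ) : ∫ w, H (z, w) = ∫ u, H (z, z - u) :=
    (integral_sub_left_eq_self (fun w => H (z, w)) volume z).symm
  simp only [h4] at h3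
  rw [integral_integral_swap iH3] at h3
  have h5 : (fun u => η u * katoIntegral V r s φ u) = fun u => ∫ z, H (z, z - u) := by
    funext u
    simp only [katoIntegral]
    rw [← integral_const_mul]
    refine integral_congr_ae (Eventually.of_forall fun z => ?_)
    simp [H, A, B]
    ring
  rw [h5]
  exact ⟨iH3.integral_prod_right, h3⟩

theorem isOpen_halfPlane : IsOpen (Ioi (0 : ℝ) ×ˢ (univ : Set ℝ)) := isOpen_Ioi.prod isOpen_univ

/-- The integrand is Lipschitz in the value of `s`, so the claim reduces to `L¹`-continuity of
translations of `s` on the support of `φ`. -/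
theorem tendsto_katoIntegral {V : ℝ} (hV : 0 ≤ V) {r s : ℝ × ℝ → ℝ}
    (hr : IsEntropyFunction V r) (hs : IsEntropyFunction V s) {φ : ℝ × ℝ → ℝ}
    (hφ : IsNonnegTest φ) :
    Tendsto (katoIntegral V r s φ) (𝓝 0) (𝓝 (katoIntegral V r s φ 0)) := by
  have hrm := hr.measurable
  have hsm := hs.measurable
  have hK := hφ.compact.isCompact
  set S := tsupport φ with hSdef
  obtain ⟨C₁, hC₁⟩ := (hφ.hasCompactSupport_fderiv_apply (1, 0)).exists_bound_of_continuous
    (hφ.continuous_fderiv_apply (1, 0))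
  obtain ⟨C₂, hC₂⟩ := (hφ.hasCompactSupport_fderiv_apply (0, 1)).exists_bound_of_continuous
    (hφ.continuous_fderiv_apply (0, 1))
  have hC₁0 : 0 ≤ C₁ := (norm_nonneg _).trans (hC₁ 0)
  have hC₂0 : 0 ≤ C₂ := (norm_nonneg _).trans (hC₂ 0)
  -- Cutting `s` off outside the `1`-thickening makes it integrable without changing `s (z - u)` for
  -- `z ∈ S` and `‖u‖ < 1`.
  set D := Metric.cthickening 1 S with hD
  have hDc : IsCompact D := hK.cthickening
  set f : ℝ × ℝ → ℝ := D.indicator s with hf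
  have hfm : Measurable f := hsm.indicator hDc.isClosed.measurableSet
  have hfi : Integrable f := by
    rw [hf, integrable_indicator_iff hDc.isClosed.measurableSet]
    refine Measure.integrableOn_of_bounded (M := 1) hDc.measure_lt_top.ne
      hsm.aestronglyMeasurable (Eventually.of_forall fun z => ?_)
    rw [Real.norm_eq_abs, abs_le]
    constructor <;> linarith [(hs.mem_Icc z).1, (hs.mem_Icc z).2]
  have hL1 : Tendsto (fun u => ∫⁻ z in S, ‖f (z - u) - f z‖ₑ) (𝓝 (0 : ℝ × ℝ)) (𝓝 0) := by
    refine tendsto_setLIntegral_comp_sub (T := fun u z => z - u) hfi hfm hK.measure_lt_top.ne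
      (Eventually.of_forall fun u => by fun_prop) (fun z => ?_) (C := 1) (by simp)
      (Eventually.of_forall fun u => ?_)
    · have : Tendsto (fun u : ℝ × ℝ => z - u) (𝓝 0) (𝓝 (z - 0)) :=
        tendsto_const_nhds.sub tendsto_id
      simpa using this
    · rw [one_smul]
      exact (measurePreserving_sub_right volume u).map_eq.le
  have hbound : ∀ᶠ u in 𝓝 (0 : ℝ × ℝ), ‖katoIntegral V r s φ u - katoIntegral V r s φ 0‖ₑ
      ≤ ENNReal.ofReal (C₁ + 2 * V * C₂) * ∫⁻ z in S, ‖f (z - u) - f z‖ₑ := by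
    filter_upwards [Metric.ball_mem_nhds (0 : ℝ × ℝ) one_pos] with u hu
    have hI (u : ℝ × ℝ) : Integrable fun z => (|r z - s (z - u)| * fderiv ℝ φ z (1, 0)
        + entropyFlux V (r z) (s (z - u)) * fderiv ℝ φ z (0, 1)) := by
      refine Integrable.add ?_ ?_
      · exact integrable_bdd_mul_of_hasCompactSupport (M := 1) (by fun_prop)
          (fun z => abs_sub_le_one_of_mem_Icc (hr.mem_Icc _) (hs.mem_Icc _))
          (hφ.continuous_fderiv_apply _) (hφ.hasCompactSupport_fderiv_apply _)
      · exact integrable_bdd_mul_of_hasCompactSupport (M := V)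
          (measurable_entropyFlux V hrm (by fun_prop))
          (fun z => abs_entropyFlux_le_of_mem_Icc hV (hr.mem_Icc _) (hs.mem_Icc _))
          (hφ.continuous_fderiv_apply _) (hφ.hasCompactSupport_fderiv_apply _)
    rw [katoIntegral, katoIntegral, ← integral_sub (hI u) (hI 0)]
    refine (enorm_integral_le_lintegral_enorm _).trans ?_
    rw [← lintegral_const_mul _ (by fun_prop), ← lintegral_indicator hK.isClosed.measurableSet]
    refine lintegral_mono fun z => ?_
    by_cases hz : z ∈ S
    · rw [indicator_of_mem hz, ← ofReal_norm, ← ofReal_norm,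
        ← ENNReal.ofReal_mul (by positivity)]
      refine ENNReal.ofReal_le_ofReal ?_
      have e0 : f z = s z := indicator_of_mem (Metric.self_subset_cthickening S hz) _
      have e1 : f (z - u) = s (z - u) := by
        refine indicator_of_mem (Metric.mem_cthickening_of_dist_le _ z _ _ hz ?_) _
        simpa [dist_eq_norm] using (mem_ball_zero_iff.mp hu).le
      rw [e0, e1, sub_zero]
      simp only [Real.norm_eq_abs] at hC₁ hC₂ ⊢
      have k1 : |(|r z - s (z - u)| - |r z - s z|)| ≤ |s (z - u) - s z| := by
        have := abs_abs_sub_abs_le (r z - s (z - u)) (r z - s z)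
        rwa [show r z - s (z - u) - (r z - s z) = -(s (z - u) - s z) by ring, abs_neg] at this
      have k2 := abs_entropyFlux_sub_le hV (hr.mem_Icc z) (hs.mem_Icc (z - u)) (hs.mem_Icc z)
      calc _ = |(|r z - s (z - u)| - |r z - s z|) * fderiv ℝ φ z (1, 0)
            + (entropyFlux V (r z) (s (z - u)) - entropyFlux V (r z) (s z))
              * fderiv ℝ φ z (0, 1)| := by congr 1; ring
        _ ≤ |(|r z - s (z - u)| - |r z - s z|)| * |fderiv ℝ φ z (1, 0)|
            + |entropyFlux V (r z) (s (z - u)) - entropyFlux V (r z) (s z)|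
              * |fderiv ℝ φ z (0, 1)| := by
            rw [← abs_mul, ← abs_mul]; exact abs_add_le _ _
        _ ≤ |s (z - u) - s z| * C₁ + (2 * V * |s (z - u) - s z|) * C₂ := by
            gcongr
            · exact hC₁ z
            · exact hC₂ z
        _ = _ := by ring
    · have : fderiv ℝ φ z = 0 := image_eq_zero_of_notMem_tsupport
        fun h => hz (tsupport_fderiv_subset ℝ h)
      simp [this]
  have hlim : Tendsto (fun u => ENNReal.ofReal (C₁ + 2 * V * C₂) * ∫⁻ z in S, ‖f (z - u) - f z‖ₑ)
      (𝓝 (0 : ℝ × ℝ)) (𝓝 0) := by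
    simpa using ENNReal.Tendsto.const_mul hL1 (Or.inr ENNReal.ofReal_ne_top)
  rw [tendsto_iff_edist_tendsto_0]
  simp only [edist_eq_enorm_sub]
  exact tendsto_of_tendsto_of_tendsto_of_le_of_le' tendsto_const_nhds hlim
    (Eventually.of_forall fun _ => zero_le) hbound

/-- **Kato inequality** for two entropy functions, by doubling of variables. -/
theorem IsEntropyFunction.kato {V : ℝ} (hV : 0 ≤ V) {r s : ℝ × ℝ → ℝ}
    (hr : IsEntropyFunction V r) (hs : IsEntropyFunction V s) {φ : ℝ × ℝ → ℝ}
    (hφ : IsNonnegTest φ) :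
    0 ≤ ∫ z, (|r z - s z| * fderiv ℝ φ z (1, 0)
      + entropyFlux V (r z) (s z) * fderiv ℝ φ z (0, 1)) := by
  have h0 : katoIntegral V r s φ 0 = ∫ z, (|r z - s z| * fderiv ℝ φ z (1, 0)
      + entropyFlux V (r z) (s z) * fderiv ℝ φ z (0, 1)) := by simp [katoIntegral]
  rw [← h0]
  -- A negative value at shift `0` would persist, up to a factor `1/2`, for shifts below `ε`. A bump
  -- supported there, and within `δ` so that the shifted support of `φ` stays in positive times,
  -- would have a negative average.
  by_contra! hneg
  have hlim := tendsto_katoIntegral hV hr hs hφ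
  obtain ⟨δ, hδ, hδU⟩ := hφ.compact.isCompact.exists_cthickening_subset_open isOpen_halfPlane
    hφ.support
  obtain ⟨ε, hε, hεG⟩ := Metric.eventually_nhds_iff_ball.mp
    (hlim.eventually (gt_mem_nhds (show _ < katoIntegral V r s φ 0 / 2 by linarith)))
  let η : ContDiffBump (0 : ℝ × ℝ) :=
    ⟨min δ ε / 4, min δ ε / 2, by positivity, by have := lt_min hδ hε; linarith⟩
  have hηout : η.rOut < min δ ε := by
    have := lt_min hδ hε
    change min δ ε / 2 < _
    linarith
  obtain ⟨hi, hmain⟩ := integrable_and_integral_mul_katoIntegral_nonneg hV hr hs hφ (η := η) η.contDiff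
    η.hasCompactSupport (fun u => η.nonneg) (by
      intro z hz u hu
      rw [η.tsupport_eq, mem_closedBall_zero_iff] at hu
      refine hδU (Metric.mem_cthickening_of_dist_le _ z _ _ hz ?_)
      simp only [dist_eq_norm, sub_sub_cancel_left, norm_neg]
      exact hu.trans (hηout.le.trans (min_le_left _ _)))
  have hle : ∫ u, η u * katoIntegral V r s φ u ≤ ∫ u, η u * (katoIntegral V r s φ 0 / 2) := by
    refine integral_mono hi (η.integrable.mul_const _) fun u => ?_
    by_cases hu : u ∈ Metric.ball (0 : ℝ × ℝ) ε
    · exact mul_le_mul_of_nonneg_left (hεG u hu).le η.nonneg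
    · have : η u = 0 := by
        refine η.zero_of_le_dist ?_
        have := hηout.le.trans (min_le_right _ _)
        simp only [Metric.mem_ball, not_lt] at hu
        linarith
      simp [this]
  rw [integral_mul_const] at hle
  have hpos : 0 < ∫ u, η u := η.integral_pos
  nlinarith

/-! ### Dissipative pairs and test functions reaching the initial time -/

/-- A nonnegative density `a` with flux `b` which is dissipated on `]0,∞[ × ℝ` in the sense of
distributions, whose speed of propagation is at most `L` and whose initial mass is at most `M`. -/
structure IsDissipativePair (L M : ℝ) (a b : ℝ × ℝ → ℝ) : Prop where
  measurable_density : Measurable a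
  measurable_flux : Measurable b
  speed_nonneg : 0 ≤ L
  mass_nonneg : 0 ≤ M
  nonneg : ∀ z, 0 ≤ a z
  le_one : ∀ z, a z ≤ 1
  abs_flux_le : ∀ z, |b z| ≤ L * a z
  dissipation : ∀ φ : ℝ × ℝ → ℝ, IsNonnegTest φ →
    0 ≤ ∫ z, (a z * fderiv ℝ φ z (1, 0) + b z * fderiv ℝ φ z (0, 1))
  initial : ∀ η > 0, ∃ d > 0, ∀ᵐ t : ℝ, t ∈ Ioo 0 d →
    ∫⁻ x, ENNReal.ofReal (a (t, x)) ≤ ENNReal.ofReal (M + η)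

/-- A smooth time cutoff, equal to `0` for `t ≤ τ` and to `1` for `2 τ ≤ t`. -/
noncomputable def timeCutoff (τ t : ℝ) : ℝ := Real.smoothTransition (t / τ - 1)

theorem contDiff_timeCutoff (τ : ℝ) : ContDiff ℝ ∞ (timeCutoff τ) :=
  Real.smoothTransition.contDiff.comp (by fun_prop)

theorem timeCutoff_nonneg (τ t : ℝ) : 0 ≤ timeCutoff τ t := Real.smoothTransition.nonneg _

theorem timeCutoff_le_one (τ t : ℝ) : timeCutoff τ t ≤ 1 := Real.smoothTransition.le_one _

theorem timeCutoff_eq_zero {τ t : ℝ} (hτ : 0 < τ) (ht : t ≤ τ) : timeCutoff τ t = 0 :=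
  Real.smoothTransition.zero_of_nonpos (by rw [sub_nonpos, div_le_one hτ]; exact ht)

theorem timeCutoff_eq_one {τ t : ℝ} (hτ : 0 < τ) (ht : 2 * τ ≤ t) : timeCutoff τ t = 1 :=
  Real.smoothTransition.one_of_one_le (by rw [le_sub_iff_add_le, le_div_iff₀ hτ]; linarith)

theorem monotone_timeCutoff {τ : ℝ} (hτ : 0 < τ) : Monotone (timeCutoff τ) := fun s t h =>
  Real.smoothTransition.monotone (by gcongr)

theorem deriv_timeCutoff_eq_zero {τ t : ℝ} (hτ : 0 < τ) (ht : t ∉ Icc τ (2 * τ)) :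
    deriv (timeCutoff τ) t = 0 := by
  rw [mem_Icc, not_and_or, not_le, not_le] at ht
  rcases ht with h | h
  · have : timeCutoff τ =ᶠ[𝓝 t] fun _ => 0 := by
      filter_upwards [Iio_mem_nhds h] with s hs using timeCutoff_eq_zero hτ (le_of_lt hs)
    rw [this.deriv_eq, deriv_const]
  · have : timeCutoff τ =ᶠ[𝓝 t] fun _ => 1 := by
      filter_upwards [Ioi_mem_nhds h] with s hs using timeCutoff_eq_one hτ (le_of_lt hs)
    rw [this.deriv_eq, deriv_const]

/-- The mass is one for every `τ`, so the initial layer created by the cutoff costs no more than the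
initial mass as `τ` tends to `0`. -/
theorem lintegral_deriv_timeCutoff {τ : ℝ} (hτ : 0 < τ) :
    ∫⁻ t, ENNReal.ofReal (deriv (timeCutoff τ) t) = 1 := by
  have hcont : Continuous (deriv (timeCutoff τ)) :=
    (contDiff_timeCutoff τ).continuous_deriv (by simp)
  have h1 : ∫⁻ t, ENNReal.ofReal (deriv (timeCutoff τ) t)
      = ∫⁻ t in Ioc 0 (2 * τ), ENNReal.ofReal (deriv (timeCutoff τ) t) := by
    rw [← lintegral_indicator measurableSet_Ioc]
    refine lintegral_congr fun t => ?_
    by_cases ht : t ∈ Ioc 0 (2 * τ)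
    · rw [indicator_of_mem ht]
    · rw [indicator_of_notMem ht, deriv_timeCutoff_eq_zero hτ, ENNReal.ofReal_zero]
      exact fun h => ht ⟨hτ.trans_le h.1, h.2⟩
  rw [h1, ← ofReal_integral_eq_lintegral_ofReal
      ((hcont.integrableOn_Icc (a := 0) (b := 2 * τ)).mono_set Ioc_subset_Icc_self)
      (Eventually.of_forall fun t => (monotone_timeCutoff hτ).deriv_nonneg),
    ← intervalIntegral.integral_of_le (by positivity),
    intervalIntegral.integral_deriv_eq_sub
      (fun t _ => (contDiff_timeCutoff τ).differentiable (by simp) t)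
      (hcont.intervalIntegrable _ _),
    timeCutoff_eq_one hτ le_rfl, timeCutoff_eq_zero hτ hτ.le]
  simp

/-- The dissipation inequality for test functions which do not vanish at the initial time. -/
theorem IsDissipativePair.integral_add_nonneg {L M : ℝ} {a b : ℝ × ℝ → ℝ}
    (h : IsDissipativePair L M a b) {Φ : ℝ × ℝ → ℝ} (hΦ : ContDiff ℝ ∞ Φ)
    (hΦ0 : ∀ z, 0 ≤ Φ z) (hΦ1 : ∀ z, Φ z ≤ 1) {R : ℝ}
    (hR : ∀ t x, 0 < t → R ≤ t ∨ R ≤ |x| → Φ (t, x) = 0) :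
    IntegrableOn (fun z => a z * fderiv ℝ Φ z (1, 0) + b z * fderiv ℝ Φ z (0, 1))
      (Ioi (0 : ℝ) ×ˢ univ) ∧
    0 ≤ (∫ z in Ioi (0 : ℝ) ×ˢ (univ : Set ℝ),
      (a z * fderiv ℝ Φ z (1, 0) + b z * fderiv ℝ Φ z (0, 1))) + M := by
  have ham := h.measurable_density
  have hbm := h.measurable_flux
  have hΦd : Differentiable ℝ Φ := hΦ.differentiable (by simp)
  have hΦ' (v : ℝ × ℝ) : Continuous fun z => fderiv ℝ Φ z v :=
    (hΦ.continuous_fderiv (by simp)).clm_apply continuous_const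
  have hΦ'm (v : ℝ × ℝ) : Measurable fun z => fderiv ℝ Φ z v := (hΦ' v).measurable
  have hΦm : Measurable Φ := hΦ.continuous.measurable
  set D : ℝ × ℝ → ℝ := fun z => a z * fderiv ℝ Φ z (1, 0) + b z * fderiv ℝ Φ z (0, 1) with hD
  set H : Set (ℝ × ℝ) := Ioi (0 : ℝ) ×ˢ univ with hH
  have hHm : MeasurableSet H := isOpen_halfPlane.measurableSet
  have hDm : Measurable D := by fun_prop
  set K : Set (ℝ × ℝ) := Icc 0 R ×ˢ Icc (-R) R with hK
  have hKc : IsCompact K := isCompact_Icc.prod isCompact_Icc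
  have hD0 : ∀ z ∈ H \ K, D z = 0 := by
    rintro ⟨t, x⟩ ⟨ht, hz⟩
    have ht : 0 < t := by simpa [hH] using ht
    have hz : R < t ∨ R < |x| := by
      by_contra! hcon
      exact hz ⟨⟨ht.le, hcon.1⟩, abs_le.mp hcon.2⟩
    have hopen : IsOpen {w : ℝ × ℝ | 0 < w.1 ∧ (R < w.1 ∨ R < |w.2|)} :=
      (isOpen_lt continuous_const continuous_fst).inter
        ((isOpen_lt continuous_const continuous_fst).union
          (isOpen_lt continuous_const continuous_snd.abs))
    have : Φ =ᶠ[𝓝 (t, x)] fun _ => 0 := by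
      filter_upwards [hopen.mem_nhds (show (t, x) ∈ _ from ⟨ht, hz⟩)] with w hw
      exact hR w.1 w.2 hw.1 (hw.2.imp le_of_lt le_of_lt)
    simp [hD, this.fderiv_eq]
  obtain ⟨C₁, hC₁⟩ := hKc.exists_bound_of_continuousOn (hΦ' (1, 0)).continuousOn
  obtain ⟨C₂, hC₂⟩ := hKc.exists_bound_of_continuousOn (hΦ' (0, 1)).continuousOn
  have hbL (z) : |b z| ≤ L := (h.abs_flux_le z).trans
    (mul_le_of_le_one_right h.speed_nonneg (h.le_one z))
  have hDint : IntegrableOn D H := by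
    refine IntegrableOn.of_forall_sdiff_eq_zero (s := K) ?_ hHm hD0
    refine Measure.integrableOn_of_bounded (M := 1 * C₁ + L * C₂) hKc.measure_lt_top.ne
      hDm.aestronglyMeasurable ?_
    filter_upwards [ae_restrict_mem hKc.isClosed.measurableSet] with z hz
    refine (norm_add_le _ _).trans ?_
    rw [norm_mul, norm_mul]
    gcongr
    · rw [Real.norm_of_nonneg (h.nonneg z)]; exact h.le_one z
    · exact hC₁ z hz
    · exact h.speed_nonneg
    · exact hbL z
    · exact hC₂ z hz
  refine ⟨hDint, ?_⟩
  -- `Φ` need not vanish at or before time `0`; multiplication by the time cutoff makes it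
  -- admissible.
  have hfd (τ : ℝ) (z v : ℝ × ℝ) : fderiv ℝ (fun z : ℝ × ℝ => Φ z * timeCutoff τ z.1) z v
      = fderiv ℝ Φ z v * timeCutoff τ z.1 + Φ z * (deriv (timeCutoff τ) z.1 * v.1) := by
    have e1 : HasDerivAt (timeCutoff τ) (deriv (timeCutoff τ) z.1) z.1 :=
      ((contDiff_timeCutoff τ).differentiable (by simp) _).hasDerivAt
    have e := e1.comp_hasFDerivAt z (hasFDerivAt_fst (𝕜 := ℝ) (E := ℝ) (F := ℝ))
    have e2 : HasFDerivAt (fun z : ℝ × ℝ => Φ z * timeCutoff τ z.1) _ z :=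
      (hΦd z).hasFDerivAt.fun_mul e
    rw [e2.fderiv]
    simp; ring
  have htest (τ : ℝ) (hτ : 0 < τ) : IsNonnegTest fun z : ℝ × ℝ => Φ z * timeCutoff τ z.1 := by
    have hzero : ∀ z ∉ Icc τ R ×ˢ Icc (-R) R, Φ z * timeCutoff τ z.1 = 0 := by
      rintro ⟨t, x⟩ hz
      rcases le_or_gt t τ with ht | ht
      · simp [timeCutoff_eq_zero hτ ht]
      · rw [hR t x (hτ.trans ht), zero_mul]
        by_contra! hcon
        exact hz ⟨⟨ht.le, hcon.1.le⟩, abs_le.mp hcon.2.le⟩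
    refine ⟨hΦ.mul ((contDiff_timeCutoff τ).comp contDiff_fst),
      HasCompactSupport.intro (isCompact_Icc.prod isCompact_Icc) hzero, ?_,
      fun z => mul_nonneg (hΦ0 z) (timeCutoff_nonneg _ _)⟩
    refine (closure_minimal (fun z hz => ?_)
      (isClosed_Icc.prod isClosed_Icc : IsClosed (Icc τ R ×ˢ Icc (-R) R))).trans
      fun z hz => ⟨hτ.trans_le hz.1.1, trivial⟩
    by_contra hcon
    exact hz (hzero z hcon)
  have hθm (τ : ℝ) : Measurable (timeCutoff τ) := (contDiff_timeCutoff τ).continuous.measurable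
  have hθ'm (τ : ℝ) : Measurable (deriv (timeCutoff τ)) := measurable_deriv _
  -- the initial layer
  have hlayer (η : ℝ) (hη : 0 < η) : ∃ d > 0, ∀ τ, 0 < τ → 2 * τ < d →
      0 ≤ (∫ z in H, timeCutoff τ z.1 * D z) + (M + η) := by
    obtain ⟨d, hd, hinit⟩ := h.initial η hη
    refine ⟨d, hd, fun τ hτ hτd => ?_⟩
    have hMη : 0 ≤ M + η := by linarith [h.mass_nonneg]
    -- `J` is the term in which the time derivative falls on the cutoff.
    let J : ℝ × ℝ → ℝ := fun z => a z * (Φ z * deriv (timeCutoff τ) z.1)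
    have hJm : Measurable J := by fun_prop
    have hJ0 (z) : 0 ≤ J z := mul_nonneg (h.nonneg z)
      (mul_nonneg (hΦ0 z) (monotone_timeCutoff hτ).deriv_nonneg)
    have hJle : ∫⁻ z, ENNReal.ofReal (J z) ≤ ENNReal.ofReal (M + η) := by
      calc ∫⁻ z, ENNReal.ofReal (J z)
          ≤ ∫⁻ z : ℝ × ℝ, ENNReal.ofReal (deriv (timeCutoff τ) z.1)
              * ENNReal.ofReal (a z) := by
            refine lintegral_mono fun z => ?_
            have hd0 : 0 ≤ deriv (timeCutoff τ) z.1 := (monotone_timeCutoff hτ).deriv_nonneg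
            rw [← ENNReal.ofReal_mul hd0]
            refine ENNReal.ofReal_le_ofReal ?_
            have := h.nonneg z
            have h2 : Φ z * (a z * deriv (timeCutoff τ) z.1)
                ≤ 1 * (a z * deriv (timeCutoff τ) z.1) := by
              gcongr
              exact hΦ1 z
            calc J z = Φ z * (a z * deriv (timeCutoff τ) z.1) := by simp only [J]; ring
              _ ≤ _ := h2
              _ = _ := by ring
        _ = ∫⁻ t, ∫⁻ x, ENNReal.ofReal (deriv (timeCutoff τ) t) * ENNReal.ofReal (a (t, x)) := by
            rw [Measure.volume_eq_prod, lintegral_prod _ (by fun_prop)]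
        _ ≤ ∫⁻ t, ENNReal.ofReal (deriv (timeCutoff τ) t) * ENNReal.ofReal (M + η) := by
            refine lintegral_mono_ae ?_
            filter_upwards [hinit] with t ht
            rw [lintegral_const_mul _ (by fun_prop)]
            by_cases htI : t ∈ Icc τ (2 * τ)
            · gcongr
              exact ht ⟨hτ.trans_le htI.1, htI.2.trans_lt hτd⟩
            · simp [deriv_timeCutoff_eq_zero hτ htI]
        _ = ENNReal.ofReal (M + η) := by
            rw [lintegral_mul_const _ (by fun_prop), lintegral_deriv_timeCutoff hτ, one_mul]
    have hJint : Integrable J := by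
      refine ⟨hJm.aestronglyMeasurable, ?_⟩
      rw [hasFiniteIntegral_iff_ofReal (Eventually.of_forall hJ0)]
      exact hJle.trans_lt ENNReal.ofReal_lt_top
    have hJI : ∫ z, J z ≤ M + η := by
      rw [integral_eq_lintegral_of_nonneg_ae (Eventually.of_forall hJ0) hJm.aestronglyMeasurable]
      exact ENNReal.toReal_le_of_le_ofReal hMη hJle
    have hzeroH : ∀ z ∉ H, timeCutoff τ z.1 * D z = 0 := by
      intro z hz
      have : z.1 ≤ 0 := by simpa [hH] using hz
      simp [timeCutoff_eq_zero hτ (this.trans hτ.le)]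
    have hθD : Integrable fun z => timeCutoff τ z.1 * D z := by
      rw [← integrableOn_iff_integrable_of_support_subset (s := H)
        (fun z hz => by_contra fun hcon => hz (hzeroH z hcon))]
      refine Integrable.bdd_mul (c := 1) hDint
        ((hθm τ).comp measurable_fst).aestronglyMeasurable (Eventually.of_forall fun z => ?_)
      rw [Real.norm_of_nonneg (timeCutoff_nonneg _ _)]
      exact timeCutoff_le_one _ _
    have key := h.dissipation _ (htest τ hτ)
    have hsplit : (fun z : ℝ × ℝ =>
        (a z * fderiv ℝ (fun z : ℝ × ℝ => Φ z * timeCutoff τ z.1) z (1, 0)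
          + b z * fderiv ℝ (fun z : ℝ × ℝ => Φ z * timeCutoff τ z.1) z (0, 1)))
        = fun z => timeCutoff τ z.1 * D z + J z := by
      funext z
      rw [hfd, hfd]
      simp only [D, J]
      ring
    rw [hsplit, integral_add hθD hJint] at key
    rw [setIntegral_eq_integral_of_forall_compl_eq_zero hzeroH]
    linarith
  -- passage to the limit
  have hlim : Tendsto (fun n : ℕ => ∫ z in H, timeCutoff (1 / ((n : ℝ) + 1)) z.1 * D z) atTop
      (𝓝 (∫ z in H, D z)) := by
    refine tendsto_integral_of_dominated_convergence (fun z => ‖D z‖)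
      (fun n => by fun_prop) hDint.norm (fun n => Eventually.of_forall fun z => ?_) ?_
    · rw [norm_mul, Real.norm_of_nonneg (timeCutoff_nonneg _ _)]
      exact mul_le_of_le_one_left (norm_nonneg _) (timeCutoff_le_one _ _)
    · filter_upwards [ae_restrict_mem hHm] with z hz
      have hz : 0 < z.1 := by simpa [hH] using hz
      refine tendsto_const_nhds.congr' ?_
      have hsm : ∀ᶠ n : ℕ in atTop, 1 / ((n : ℝ) + 1) < z.1 / 2 :=
        tendsto_one_div_add_atTop_nhds_zero_nat.eventually (gt_mem_nhds (by positivity))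
      filter_upwards [hsm] with n hn
      rw [timeCutoff_eq_one (by positivity) (by linarith), one_mul]
  refine le_of_forall_pos_le_add fun η hη => ?_
  obtain ⟨d, hd, hlay⟩ := hlayer η hη
  have := ge_of_tendsto (hlim.add_const (M + η)) (b := 0) ?_
  · linarith
  · have hsm : ∀ᶠ n : ℕ in atTop, 1 / ((n : ℝ) + 1) < d / 2 :=
      tendsto_one_div_add_atTop_nhds_zero_nat.eventually (gt_mem_nhds (by positivity))
    filter_upwards [hsm] with n hn
    exact hlay _ (by positivity) (by linarith)

/-! ### Cone weights and uniqueness -/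

/-- A smooth function which is positive on a bounded cone and decreases along all directions of
speed less than `c`. -/
noncomputable def coneHeight (R c : ℝ) (z : ℝ × ℝ) : ℝ := R - √(1 + z.2 ^ 2) - c * z.1

theorem contDiff_coneHeight (R c : ℝ) : ContDiff ℝ ∞ (coneHeight R c) := by
  have : ContDiff ℝ ∞ fun z : ℝ × ℝ => √(1 + z.2 ^ 2) :=
    ContDiff.sqrt (by fun_prop) fun z => by positivity
  unfold coneHeight
  fun_prop

/-- `√(1 + x²)` is a smooth substitute for `|x|` with slope at most one. For nondecreasing `g` the
weight `g ∘ coneHeight` then gives `a ∂ₜ + b ∂ₓ` a contribution of at most `-(c - L) * a * g'`. -/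
theorem exists_fderiv_comp_coneHeight {g : ℝ → ℝ} (hg : Differentiable ℝ g) (R c : ℝ) (z : ℝ × ℝ) :
    ∃ s : ℝ, |s| ≤ 1 ∧
      fderiv ℝ (fun z => g (coneHeight R c z)) z (1, 0) = -c * deriv g (coneHeight R c z) ∧
      fderiv ℝ (fun z => g (coneHeight R c z)) z (0, 1) = s * deriv g (coneHeight R c z) := by
  have hpos : 0 < 1 + z.2 ^ 2 := by positivity
  refine ⟨-(z.2 / √(1 + z.2 ^ 2)), ?_, ?_⟩
  · rw [abs_neg, abs_div, abs_of_nonneg (Real.sqrt_nonneg _), div_le_one (Real.sqrt_pos.mpr hpos)]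
    exact Real.abs_le_sqrt (by linarith)
  have hd : Differentiable ℝ (coneHeight R c) := (contDiff_coneHeight R c).differentiable (by simp)
  have hcomp : HasFDerivAt (fun z => g (coneHeight R c z)) _ z :=
    (hg (coneHeight R c z)).hasDerivAt.comp_hasFDerivAt z (hd z).hasFDerivAt
  have hline (v : ℝ × ℝ) (d : ℝ)
      (h : HasDerivAt (fun u : ℝ => coneHeight R c (z + u • v)) d 0) :
      fderiv ℝ (coneHeight R c) z v = d :=
    ((hd z).hasFDerivAt.hasLineDerivAt v).unique h
  have h1 : fderiv ℝ (coneHeight R c) z (1, 0) = -c := by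
    refine hline _ _ ?_
    have : HasDerivAt (fun u : ℝ => R - √(1 + z.2 ^ 2) - c * (z.1 + u)) (-(c * 1)) 0 :=
      (((hasDerivAt_id (0 : ℝ)).const_add z.1).const_mul c).const_sub _
    simpa [coneHeight] using this
  have h2 : fderiv ℝ (coneHeight R c) z (0, 1) = -(z.2 / √(1 + z.2 ^ 2)) := by
    refine hline _ _ ?_
    have e1 : HasDerivAt (fun u : ℝ => 1 + (z.2 + u) ^ 2) (2 * z.2) 0 := by
      have := (((hasDerivAt_id (0 : ℝ)).const_add z.2).pow 2).const_add 1
      simpa using this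
    have e2 : HasDerivAt (fun u : ℝ => √(1 + (z.2 + u) ^ 2)) (z.2 / √(1 + z.2 ^ 2)) 0 := by
      have := e1.sqrt (by positivity)
      refine this.congr_deriv ?_
      rw [add_zero, mul_div_mul_left _ _ two_ne_zero]
    have := (e2.const_sub R).sub_const (c * z.1)
    simpa [coneHeight] using this
  rw [hcomp.fderiv]
  simp [h1, h2, mul_comm]

theorem coneHeight_nonpos {R c t x : ℝ} (hc : 1 ≤ c) (ht : 0 < t) (h : R ≤ t ∨ R ≤ |x|) :
    coneHeight R c (t, x) ≤ 0 := by
  have h1 : |x| ≤ √(1 + x ^ 2) := Real.abs_le_sqrt (by linarith)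
  have h2 : t ≤ c * t := le_mul_of_one_le_left ht.le hc
  have := abs_nonneg x
  simp only [coneHeight]
  rcases h with h | h <;> linarith

theorem expNegInvGlue_le_one (x : ℝ) : expNegInvGlue x ≤ 1 := by
  unfold expNegInvGlue
  split_ifs with h
  · exact zero_le_one
  · exact Real.exp_le_one_iff.mpr (by simpa using (not_le.mp h).le)

/-- Strict positivity of this derivative forces the density to vanish wherever the cone height is
positive. -/
theorem deriv_expNegInvGlue_pos {x : ℝ} (hx : 0 < x) : 0 < deriv expNegInvGlue x := by
  have h := expNegInvGlue.hasDerivAt_polynomial_eval_inv_mul 1 x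
  simp only [Polynomial.eval_one, one_mul, Polynomial.derivative_one, sub_zero, mul_one,
    Polynomial.eval_pow, Polynomial.eval_X] at h
  have h' : HasDerivAt expNegInvGlue _ x := h
  rw [h'.deriv]
  have := expNegInvGlue.pos_of_pos hx
  positivity

/-- A dissipative pair without initial mass vanishes. -/
theorem IsDissipativePair.ae_eq_zero {L : ℝ} {a b : ℝ × ℝ → ℝ} (h : IsDissipativePair L 0 a b) :
    ∀ᵐ z ∂(volume.restrict (Ioi (0 : ℝ) ×ˢ (univ : Set ℝ))), a z = 0 := by
  have hL := h.speed_nonneg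
  have hg : ContDiff ℝ ∞ expNegInvGlue := expNegInvGlue.contDiff
  have hgd : Differentiable ℝ expNegInvGlue := hg.differentiable (by simp)
  have hR (n : ℕ) : ∀ᵐ z ∂(volume.restrict (Ioi (0 : ℝ) ×ˢ (univ : Set ℝ))),
      0 < coneHeight n (L + 1) z → a z = 0 := by
    set Φ : ℝ × ℝ → ℝ := fun z => expNegInvGlue (coneHeight n (L + 1) z) with hΦ
    obtain ⟨hint, hnn⟩ := h.integral_add_nonneg (Φ := Φ) (R := n)
      (hg.comp (contDiff_coneHeight _ _)) (fun z => expNegInvGlue.nonneg _)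
      (fun z => expNegInvGlue_le_one _) (fun t x ht hx => expNegInvGlue.zero_of_nonpos
        (coneHeight_nonpos (by linarith) ht hx))
    -- The cone speed `L + 1` exceeds the propagation speed by one, so a full `a z` is left after
    -- the flux is absorbed.
    have hle (z : ℝ × ℝ) : a z * deriv expNegInvGlue (coneHeight n (L + 1) z)
        ≤ -(a z * fderiv ℝ Φ z (1, 0) + b z * fderiv ℝ Φ z (0, 1)) := by
      obtain ⟨s, hs, e1, e2⟩ := exists_fderiv_comp_coneHeight hgd n (L + 1) z
      rw [hΦ, e1, e2]
      have hd : 0 ≤ deriv expNegInvGlue (coneHeight n (L + 1) z) :=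
        expNegInvGlue.monotone.deriv_nonneg
      have hbs : b z * s ≤ L * a z := by
        refine (le_abs_self _).trans ?_
        rw [abs_mul]
        calc |b z| * |s| ≤ |b z| * 1 := by gcongr
          _ ≤ _ := by rw [mul_one]; exact h.abs_flux_le z
      nlinarith
    have hnonneg (z : ℝ × ℝ) :
        0 ≤ -(a z * fderiv ℝ Φ z (1, 0) + b z * fderiv ℝ Φ z (0, 1)) :=
      (mul_nonneg (h.nonneg z) expNegInvGlue.monotone.deriv_nonneg).trans (hle z)
    have hzero : ∫ z in Ioi (0 : ℝ) ×ˢ (univ : Set ℝ),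
        -(a z * fderiv ℝ Φ z (1, 0) + b z * fderiv ℝ Φ z (0, 1)) = 0 := by
      refine le_antisymm ?_ (integral_nonneg hnonneg)
      rw [integral_neg]
      linarith
    rw [integral_eq_zero_iff_of_nonneg hnonneg hint.neg] at hzero
    filter_upwards [hzero] with z hz hpos
    have h1 := hle z
    rw [hz] at h1
    have h2 := deriv_expNegInvGlue_pos hpos
    have h3 := h.nonneg z
    simp only [Pi.zero_apply] at h1
    nlinarith
  filter_upwards [ae_all_iff.mpr hR] with z hz
  obtain ⟨n, hn⟩ := exists_nat_gt (√(1 + z.2 ^ 2) + (L + 1) * z.1)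
  exact hz n (by simp only [coneHeight]; linarith)

/-! ### Mass near a curve faster than the flow -/

/-- The mass of a dissipative pair near a curve which is faster than the flow is controlled by the
initial mass and the width of the neighbourhood. -/
theorem IsDissipativePair.setLIntegral_le {L M m δ ε B : ℝ} {a b : ℝ × ℝ → ℝ}
    (h : IsDissipativePair L M a b) (hδ : 0 < δ) (hε : 0 < ε)
    (hb : ∀ z, b z ≤ (m - δ) * a z) {q : ℝ → ℝ} (hq : ContDiff ℝ ∞ q) (hq' : ∀ t, m ≤ deriv q t)
    {S : Set (ℝ × ℝ)} (hS : MeasurableSet S)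
    (hSB : ∀ z ∈ S, 0 < z.1 ∧ z.1 ≤ B ∧ |z.2| ≤ B ∧ |z.2 - q z.1| ≤ 2 * ε) :
    ∫⁻ z in S, ENNReal.ofReal (a z) ≤ ENNReal.ofReal (5 * Real.pi * ε / δ * M) := by
  have hL := h.speed_nonneg
  have hπ := Real.pi_pos
  have hg : ContDiff ℝ ∞ Real.smoothTransition := Real.smoothTransition.contDiff
  have hgd : Differentiable ℝ Real.smoothTransition := hg.differentiable (by simp)
  set c : ℝ := L + 1 with hc
  -- With this `R` the cone height is at least `1` for `t ≤ B` and `|x| ≤ B`, so the cutoff `G`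
  -- equals `1` on `S`.
  set R : ℝ := 1 + √(1 + B ^ 2) + c * B with hR
  -- A step in `[0, 1]` increasing across the curve; its space derivative `κ` is a Cauchy kernel of
  -- width `ε`.
  set F : ℝ × ℝ → ℝ := fun z => Real.arctan ((z.2 - q z.1) / ε) / Real.pi + 1 / 2 with hF
  set G : ℝ × ℝ → ℝ := fun z => Real.smoothTransition (coneHeight R c z) with hG
  have hFs : ContDiff ℝ ∞ F := by
    have : ContDiff ℝ ∞ fun z : ℝ × ℝ => q z.1 := hq.comp contDiff_fst
    have h2 : ContDiff ℝ ∞ fun z : ℝ × ℝ => Real.arctan ((z.2 - q z.1) / ε) :=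
      Real.contDiff_arctan.comp (by fun_prop)
    fun_prop
  have hGs : ContDiff ℝ ∞ G := hg.comp (contDiff_coneHeight _ _)
  have hF0 (z) : 0 ≤ F z := by
    have := Real.neg_pi_div_two_lt_arctan ((z.2 - q z.1) / ε)
    have h2 : -(1 / 2) ≤ Real.arctan ((z.2 - q z.1) / ε) / Real.pi := by
      rw [le_div_iff₀ hπ]; linarith
    simp only [hF]; linarith
  have hF1 (z) : F z ≤ 1 := by
    have := Real.arctan_lt_pi_div_two ((z.2 - q z.1) / ε)
    have h2 : Real.arctan ((z.2 - q z.1) / ε) / Real.pi ≤ 1 / 2 := by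
      rw [div_le_iff₀ hπ]; linarith
    simp only [hF]; linarith
  have hG0 (z) : 0 ≤ G z := Real.smoothTransition.nonneg _
  have hG1 (z) : G z ≤ 1 := Real.smoothTransition.le_one _
  obtain ⟨hint, hnn⟩ := h.integral_add_nonneg (Φ := fun z => F z * G z) (R := R)
    (hFs.mul hGs) (fun z => mul_nonneg (hF0 z) (hG0 z))
    (fun z => mul_le_one₀ (hF1 z) (hG0 z) (hG1 z)) (fun t x ht hx => by
      simp only [hG]
      rw [Real.smoothTransition.zero_of_nonpos (coneHeight_nonpos (by linarith) ht hx), mul_zero])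
  set D : ℝ × ℝ → ℝ := fun z =>
    a z * fderiv ℝ (fun z => F z * G z) z (1, 0) + b z * fderiv ℝ (fun z => F z * G z) z (0, 1)
    with hD
  let κ : ℝ × ℝ → ℝ := fun z => 1 / (1 + ((z.2 - q z.1) / ε) ^ 2) * (1 / ε) / Real.pi
  have hκ0 (z) : 0 ≤ κ z := by positivity
  have hFfd (z) : fderiv ℝ F z (1, 0) = -(deriv q z.1 * κ z) ∧ fderiv ℝ F z (0, 1) = κ z := by
    have e0 : HasFDerivAt (fun z : ℝ × ℝ => q z.1) _ z :=
      ((hq.differentiable (by simp) z.1).hasDerivAt).comp_hasFDerivAt z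
        (hasFDerivAt_fst (𝕜 := ℝ) (E := ℝ) (F := ℝ))
    have e1 := ((hasFDerivAt_snd (𝕜 := ℝ) (E := ℝ) (F := ℝ) (p := z)).fun_sub e0).mul_const ε⁻¹
    have e2 : HasFDerivAt F _ z := (((Real.hasDerivAt_arctan _).comp_hasFDerivAt z e1).mul_const
      Real.pi⁻¹).add_const (1 / 2)
    rw [e2.fderiv]
    simp only [κ, div_eq_mul_inv]
    constructor
    · simp; ring
    · simp; ring
  -- The derivatives of `G` have the favourable sign since `c > L`. Those of `F` produce `κ * G *
  -- (q' * a - b)`, where the gap between the slope of the curve and the flux speed leaves `δ * a`.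
  have hle (z : ℝ × ℝ) : δ * (κ z * G z * a z) ≤ -D z := by
    obtain ⟨s, hs, e1, e2⟩ := exists_fderiv_comp_coneHeight hgd R c z
    obtain ⟨e3, e4⟩ := hFfd z
    have hfd (v) : fderiv ℝ (fun z => F z * G z) z v
        = F z * fderiv ℝ G z v + G z * fderiv ℝ F z v := by
      rw [((hFs.differentiable (by simp) z).hasFDerivAt.fun_mul
        (hGs.differentiable (by simp) z).hasFDerivAt).fderiv]
      simp
    simp only [hD]
    rw [hfd, hfd, e1, e2, e3, e4]
    have hd : 0 ≤ deriv Real.smoothTransition (coneHeight R c z) :=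
      Real.smoothTransition.monotone.deriv_nonneg
    have hbs : b z * s ≤ L * a z := by
      refine (le_abs_self _).trans ?_
      rw [abs_mul]
      calc |b z| * |s| ≤ |b z| * 1 := by gcongr
        _ ≤ _ := by rw [mul_one]; exact h.abs_flux_le z
    have ha := h.nonneg z
    have p1 : 0 ≤ (F z * deriv Real.smoothTransition (coneHeight R c z)) * (c * a z - b z * s) :=
      mul_nonneg (mul_nonneg (hF0 z) hd) (by rw [hc]; linarith)
    have p2 : 0 ≤ (κ z * G z) * (deriv q z.1 * a z - b z - δ * a z) := by
      refine mul_nonneg (mul_nonneg (hκ0 z) (hG0 z)) ?_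
      have := mul_le_mul_of_nonneg_right (hq' z.1) ha
      linarith [hb z]
    linarith
  have hnonneg (z) : 0 ≤ -D z :=
    (mul_nonneg hδ.le (mul_nonneg (mul_nonneg (hκ0 z) (hG0 z)) (h.nonneg z))).trans (hle z)
  have hSle (z) (hz : z ∈ S) : a z ≤ 5 * Real.pi * ε / δ * -D z := by
    obtain ⟨h1, h2, h3, h4⟩ := hSB z hz
    have hB : 0 < B := h1.trans_le h2
    have hGz : G z = 1 := by
      refine Real.smoothTransition.one_of_one_le ?_
      have e1 : √(1 + z.2 ^ 2) ≤ √(1 + B ^ 2) :=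
        Real.sqrt_le_sqrt (by linarith [sq_le_sq' (abs_le.mp h3).1 (abs_le.mp h3).2])
      have e2 : c * z.1 ≤ c * B := by gcongr
      simp only [coneHeight, hR]; linarith
    -- The `5` is `1 + 2²`: at distance at most `2 * ε` the Cauchy kernel is at least `1 / (5 π ε)`.
    have hκz : 1 / (5 * Real.pi * ε) ≤ κ z := by
      have e1 : ((z.2 - q z.1) / ε) ^ 2 ≤ 2 ^ 2 := by
        refine sq_le_sq' ?_ ?_
        · rw [le_div_iff₀ hε]; linarith [(abs_le.mp h4).1]
        · rw [div_le_iff₀ hε]; linarith [(abs_le.mp h4).2]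
      calc 1 / (5 * Real.pi * ε) = 1 / 5 * (1 / ε) / Real.pi := by field_simp
        _ ≤ κ z := by
          simp only [κ]
          gcongr
          linarith
    have h5 := hle z
    rw [hGz, mul_one] at h5
    have ha := h.nonneg z
    calc a z = 5 * Real.pi * ε / δ * (δ * (1 / (5 * Real.pi * ε) * a z)) := by field_simp
      _ ≤ 5 * Real.pi * ε / δ * (δ * (κ z * a z)) := by gcongr
      _ ≤ _ := by gcongr
  calc ∫⁻ z in S, ENNReal.ofReal (a z)
      ≤ ∫⁻ z in S, ENNReal.ofReal (5 * Real.pi * ε / δ * -D z) :=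
        setLIntegral_mono' hS fun z hz => ENNReal.ofReal_le_ofReal (hSle z hz)
    _ ≤ ∫⁻ z in Ioi (0 : ℝ) ×ˢ (univ : Set ℝ), ENNReal.ofReal (5 * Real.pi * ε / δ * -D z) :=
        lintegral_mono_set fun z hz => ⟨(hSB z hz).1, trivial⟩
    _ = ENNReal.ofReal (∫ z in Ioi (0 : ℝ) ×ˢ (univ : Set ℝ), 5 * Real.pi * ε / δ * -D z) :=
        (ofReal_integral_eq_lintegral_ofReal (hint.neg.const_mul _)
          (Eventually.of_forall fun z => mul_nonneg (by positivity) (hnonneg z))).symm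
    _ ≤ _ := by
        refine ENNReal.ofReal_le_ofReal ?_
        rw [integral_const_mul, integral_neg]
        gcongr
        linarith

/-! ### Representatives, contraction and comparison for entropy solutions -/

theorem IsNonnegTest.fderiv_eq_zero {φ : ℝ × ℝ → ℝ} (hφ : IsNonnegTest φ) {z : ℝ × ℝ}
    (hz : z ∉ Ioi (0 : ℝ) ×ˢ (univ : Set ℝ)) : fderiv ℝ φ z = 0 :=
  image_eq_zero_of_notMem_tsupport fun h => hz (hφ.support (tsupport_fderiv_subset ℝ h))

theorem IsNonnegTest.integral_fderiv_eq_zero {φ : ℝ × ℝ → ℝ} (hφ : IsNonnegTest φ) (v : ℝ × ℝ) :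
    ∫ z, fderiv ℝ φ z v = 0 := by
  have h1 : Integrable fun z => fderiv ℝ φ z v :=
    (hφ.continuous_fderiv_apply v).integrable_of_hasCompactSupport
      (hφ.hasCompactSupport_fderiv_apply v)
  have h2 : Integrable φ := hφ.smooth.continuous.integrable_of_hasCompactSupport hφ.compact
  have := integral_mul_fderiv_eq_neg_fderiv_mul_of_integrable (μ := (volume : Measure (ℝ × ℝ)))
    (f := fun _ => (1 : ℝ)) (g := φ) (v := v) (by simp) (by simpa using h1)
    (by simpa using h2) (fun _ _ => by fun_prop)
    (fun x _ => hφ.smooth.differentiable (by simp) x)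
  simpa using this

/-- The function `r` attains the initial datum `g` in `L¹`, outside a null set of times. -/
def HasInitialDatum (g : ℝ → ℝ) (r : ℝ × ℝ → ℝ) : Prop :=
  ∀ η > 0, ∃ d > 0, ∀ᵐ t : ℝ, t ∈ Ioo 0 d →
    ∫⁻ x, ENNReal.ofReal |r (t, x) - g x| ≤ ENNReal.ofReal η

theorem ae_ae_of_ae_halfPlane {P : ℝ × ℝ → Prop}
    (h : ∀ᵐ z ∂(volume.restrict (Ioi (0 : ℝ) ×ˢ (univ : Set ℝ))), P z) :
    ∀ᵐ t : ℝ, 0 < t → ∀ᵐ x : ℝ, P (t, x) := by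
  rw [Measure.volume_eq_prod, ← Measure.prod_restrict, Measure.restrict_univ] at h
  exact (ae_restrict_iff' measurableSet_Ioi).mp (Measure.ae_ae_of_ae_prod h)

theorem HasInitialDatum.congr {g : ℝ → ℝ} {r s : ℝ × ℝ → ℝ} (h : HasInitialDatum g r)
    (hrs : ∀ᵐ z ∂(volume.restrict (Ioi (0 : ℝ) ×ˢ (univ : Set ℝ))), s z = r z) :
    HasInitialDatum g s := by
  intro η hη
  obtain ⟨d, hd, hr⟩ := h η hη
  refine ⟨d, hd, ?_⟩
  filter_upwards [hr, ae_ae_of_ae_halfPlane hrs] with t h1 h2 ht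
  refine le_of_eq_of_le (lintegral_congr_ae ?_) (h1 ht)
  filter_upwards [h2 ht.1] with x hx
  rw [hx]

theorem IsEntropyFunction.congr {V : ℝ} {r s : ℝ × ℝ → ℝ} (h : IsEntropyFunction V r)
    (hs : Measurable s) (hs' : ∀ z, s z ∈ Icc (0 : ℝ) 1)
    (hrs : ∀ᵐ z ∂(volume.restrict (Ioi (0 : ℝ) ×ˢ (univ : Set ℝ))), s z = r z) :
    IsEntropyFunction V s := by
  refine ⟨hs, hs', fun k φ hφ => (h.entropy k φ hφ).trans_eq (integral_congr_ae ?_)⟩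
  rw [ae_restrict_iff' isOpen_halfPlane.measurableSet] at hrs
  filter_upwards [hrs] with z hz
  by_cases hzH : z ∈ Ioi (0 : ℝ) ×ˢ (univ : Set ℝ)
  · rw [hz hzH]
  · simp [hφ.fderiv_eq_zero hzH]

/-- A measurable representative clamped to `[0, 1]` satisfies the bounds everywhere, and the null
set of times in the initial condition is absorbed into "a.e. `t`". The datum may be replaced by its
representative of bounded variation. -/
theorem IsKruzkovSolution.exists_isEntropyFunction {V : ℝ} {ρo g : ℝ → ℝ} {ρ : ℝ → ℝ → ℝ}
    (h : IsKruzkovSolution (lwrFlux V) ρo ρ) (hg : ρo =ᵐ[volume] g) :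
    ∃ r, IsEntropyFunction V r ∧ HasInitialDatum g r ∧
      ∀ᵐ z ∂(volume.restrict (Ioi (0 : ℝ) ×ˢ (univ : Set ℝ))), ρ z.1 z.2 = r z := by
  let r : ℝ × ℝ → ℝ := fun z => max 0 (min 1 (h.measurable.mk _ z))
  have hrm : Measurable r := by
    have := h.measurable.measurable_mk
    fun_prop
  have hae : ∀ᵐ z ∂(volume.restrict (Ioi (0 : ℝ) ×ˢ (univ : Set ℝ))), ρ z.1 z.2 = r z := by
    filter_upwards [h.measurable.ae_eq_mk, h.range] with z h1 h2
    simp only [r]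
    rw [← h1, min_eq_right h2.2, max_eq_right h2.1]
  refine ⟨r, ⟨hrm, fun z => ⟨le_max_left _ _, max_le zero_le_one (min_le_left _ _)⟩, ?_⟩, ?_, hae⟩
  · intro k φ hφ
    refine (h.entropy k φ hφ).trans_eq ?_
    have hz : ∀ z ∉ Ioi (0 : ℝ) ×ˢ (univ : Set ℝ), |r z - k| * fderiv ℝ φ z (1, 0)
        + entropyFlux V (r z) k * fderiv ℝ φ z (0, 1) = 0 :=
      fun z hz => by simp [hφ.fderiv_eq_zero hz]
    rw [← setIntegral_eq_integral_of_forall_compl_eq_zero hz]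
    refine integral_congr_ae ?_
    filter_upwards [hae] with z hz
    rw [hz, sign_mul_lwrFlux_sub]
  · intro η hη
    obtain ⟨N, hN, hlim⟩ := h.initial
    have hev := hlim.eventually (ge_mem_nhds (ENNReal.ofReal_pos.mpr hη))
    rw [eventually_nhdsWithin_iff, Metric.eventually_nhds_iff] at hev
    obtain ⟨d, hd, hd'⟩ := hev
    refine ⟨d, hd, ?_⟩
    filter_upwards [ae_ae_of_ae_halfPlane hae, measure_eq_zero_iff_ae_notMem.mp hN]
      with t h1 h2 ht
    refine le_of_eq_of_le (lintegral_congr_ae ?_)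
      (hd' (by simpa [abs_of_pos ht.1] using ht.2) ⟨ht.1, h2⟩)
    filter_upwards [h1 ht.1, hg] with x hx hgx
    rw [hgx, ← hx]

/-- Kato's inequality is the dissipation; the initial mass is the `L¹` distance of the data, by the
triangle inequality with an error `η / 2` for each function. -/
theorem IsEntropyFunction.isDissipativePair {V M : ℝ} (hV : 0 ≤ V) (hM : 0 ≤ M)
    {r s : ℝ × ℝ → ℝ} (hr : IsEntropyFunction V r) (hs : IsEntropyFunction V s) {g k : ℝ → ℝ}
    (hg : Measurable g) (hk : Measurable k)
    (hrg : HasInitialDatum g r) (hsk : HasInitialDatum k s)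
    (hgk : ∫⁻ x, ENNReal.ofReal |g x - k x| ≤ ENNReal.ofReal M) :
    IsDissipativePair V M (fun z => |r z - s z|) (fun z => entropyFlux V (r z) (s z)) where
  measurable_density := (hr.measurable.sub hs.measurable).abs
  measurable_flux := measurable_entropyFlux V hr.measurable hs.measurable
  speed_nonneg := hV
  mass_nonneg := hM
  nonneg z := abs_nonneg _
  le_one z := by simpa using abs_sub_le_one_of_mem_Icc (hr.mem_Icc z) (hs.mem_Icc z)
  abs_flux_le z := abs_entropyFlux_le hV (hr.mem_Icc z) (hs.mem_Icc z)
  dissipation φ hφ := hr.kato hV hs hφ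
  initial η hη := by
    have hrm := hr.measurable
    have hsm := hs.measurable
    obtain ⟨d₁, hd₁, h₁⟩ := hrg (η / 2) (by positivity)
    obtain ⟨d₂, hd₂, h₂⟩ := hsk (η / 2) (by positivity)
    refine ⟨min d₁ d₂, lt_min hd₁ hd₂, ?_⟩
    filter_upwards [h₁, h₂] with t k₁ k₂ ht
    calc ∫⁻ x, ENNReal.ofReal |r (t, x) - s (t, x)|
        ≤ ∫⁻ x, (ENNReal.ofReal |r (t, x) - g x| + ENNReal.ofReal |s (t, x) - k x|)
            + ENNReal.ofReal |g x - k x| := by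
          refine lintegral_mono fun x => ?_
          rw [← ENNReal.ofReal_add (abs_nonneg _) (abs_nonneg _),
            ← ENNReal.ofReal_add (by positivity) (abs_nonneg _)]
          refine ENNReal.ofReal_le_ofReal ?_
          have e : r (t, x) - s (t, x)
              = (r (t, x) - g x) + (g x - k x) + (k x - s (t, x)) := by ring
          rw [e, abs_sub_comm (s (t, x))]
          linarith [abs_add_three (r (t, x) - g x) (g x - k x) (k x - s (t, x))]
      _ = ((∫⁻ x, ENNReal.ofReal |r (t, x) - g x|) + ∫⁻ x, ENNReal.ofReal |s (t, x) - k x|)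
            + ∫⁻ x, ENNReal.ofReal |g x - k x| := by
          rw [lintegral_add_left (by fun_prop), lintegral_add_left (by fun_prop)]
      _ ≤ (ENNReal.ofReal (η / 2) + ENNReal.ofReal (η / 2)) + ENNReal.ofReal M := by
          gcongr
          · exact k₁ ⟨ht.1, ht.2.trans_le (min_le_left _ _)⟩
          · exact k₂ ⟨ht.1, ht.2.trans_le (min_le_right _ _)⟩
      _ = ENNReal.ofReal (M + η) := by
          rw [← ENNReal.ofReal_add (by positivity) (by positivity),
            ← ENNReal.ofReal_add (by positivity) hM]
          congr 1; ring

/-- Uniqueness of entropy functions with given initial datum. -/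
theorem IsEntropyFunction.ae_eq {V : ℝ} (hV : 0 ≤ V) {r s : ℝ × ℝ → ℝ}
    (hr : IsEntropyFunction V r) (hs : IsEntropyFunction V s) {g : ℝ → ℝ} (hg : Measurable g)
    (hrg : HasInitialDatum g r) (hsg : HasInitialDatum g s) :
    ∀ᵐ z ∂(volume.restrict (Ioi (0 : ℝ) ×ˢ (univ : Set ℝ))), r z = s z := by
  filter_upwards [(hr.isDissipativePair hV le_rfl hs hg hg hrg hsg (by simp)).ae_eq_zero] with z hz
  exact sub_eq_zero.mp (abs_eq_zero.mp hz)

/-- An entropy function stays above a constant lower bound of its initial datum. -/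
theorem IsEntropyFunction.ae_le {V : ℝ} (hV : 0 ≤ V) {r : ℝ × ℝ → ℝ}
    (hr : IsEntropyFunction V r) {g : ℝ → ℝ} (hrg : HasInitialDatum g r) {k : ℝ}
    (hk : k ∈ Icc (0 : ℝ) 1) (hkg : ∀ᵐ x, k ≤ g x) :
    ∀ᵐ z ∂(volume.restrict (Ioi (0 : ℝ) ×ˢ (univ : Set ℝ))), k ≤ r z := by
  have hrm := hr.measurable
  -- The pair is the half entropy `(k - r)⁺` with its flux, which is `f k - f r` where `r < k`. It
  -- has no initial mass because the datum is at least `k`.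
  have hpair : IsDissipativePair V 0 (fun z => max (k - r z) 0)
      (fun z => max (k - r z) 0 * (V * (1 - r z - k))) := by
    have hle1 (z) : max (k - r z) 0 ≤ 1 :=
      max_le (by linarith [(hr.mem_Icc z).1, hk.2]) zero_le_one
    have h0 (z) : 0 ≤ max (k - r z) 0 := le_max_right _ _
    have habs (z) : |max (k - r z) 0 * (V * (1 - r z - k))| ≤ V * max (k - r z) 0 := by
      rw [abs_mul, abs_of_nonneg (h0 z), mul_comm, abs_mul, abs_of_nonneg hV]
      have : |1 - r z - k| ≤ 1 := by
        rw [abs_le]; constructor <;> linarith [hk.1, hk.2, (hr.mem_Icc z).1, (hr.mem_Icc z).2]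
      have := mul_le_of_le_one_right hV this
      exact mul_le_mul_of_nonneg_right this (h0 z)
    refine ⟨by fun_prop, by fun_prop, hV, le_rfl, h0, hle1, habs, ?_, ?_⟩
    · intro φ hφ
      have e1 := hr.entropy k φ hφ
      -- The constant `2` lies above the range of `r`, so `|r - 2| = 2 - r` and this is one half of
      -- the weak equation. As `2 - r = 2 (k - r)⁺ - |r - k| + (2 - k)`, adding the inequality for
      -- `k` isolates the half entropy.
      have e2 := hr.entropy 2 φ hφ
      have hi (c : ℝ × ℝ → ℝ) (hc : Measurable c) (C : ℝ) (hC : ∀ z, |c z| ≤ C) (v : ℝ × ℝ) :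
          Integrable fun z => c z * fderiv ℝ φ z v :=
        integrable_bdd_mul_of_hasCompactSupport hc hC (hφ.continuous_fderiv_apply v)
          (hφ.hasCompactSupport_fderiv_apply v)
      have hi1 := hi (fun z => max (k - r z) 0) (by fun_prop) 1
        (fun z => by rw [abs_of_nonneg (h0 z)]; exact hle1 z) (1, 0)
      have hi2 := hi (fun z => max (k - r z) 0 * (V * (1 - r z - k))) (by fun_prop) V
        (fun z => (habs z).trans (mul_le_of_le_one_right hV (hle1 z))) (0, 1)
      have hi3 := hi (fun z => |r z - k|) (by fun_prop) 1
        (fun z => abs_sub_le_one_of_mem_Icc (hr.mem_Icc z) hk) (1, 0)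
      have hi4 := hi (fun z => entropyFlux V (r z) k)
        (measurable_entropyFlux V hrm measurable_const) V
        (fun z => abs_entropyFlux_le_of_mem_Icc hV (hr.mem_Icc z) hk) (0, 1)
      have hc1 := hi (fun _ => 2 - k) (by fun_prop) |2 - k| (fun _ => le_rfl) (1, 0)
      have hc2 := hi (fun _ => -V * (2 + k * (1 - k))) (by fun_prop) _ (fun _ => le_rfl) (0, 1)
      have hi12 : Integrable fun z => max (k - r z) 0 * fderiv ℝ φ z (1, 0)
          + max (k - r z) 0 * (V * (1 - r z - k)) * fderiv ℝ φ z (0, 1) := hi1.add hi2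
      have hi34 : Integrable fun z => |r z - k| * fderiv ℝ φ z (1, 0)
          + entropyFlux V (r z) k * fderiv ℝ φ z (0, 1) := hi3.add hi4
      have hc12 : Integrable fun z => (2 - k) * fderiv ℝ φ z (1, 0)
          + -V * (2 + k * (1 - k)) * fderiv ℝ φ z (0, 1) := hc1.add hc2
      have hz1 : ∫ z, (2 - k) * fderiv ℝ φ z (1, 0) = 0 := by
        rw [integral_const_mul, hφ.integral_fderiv_eq_zero, mul_zero]
      have hz2 : ∫ z, -V * (2 + k * (1 - k)) * fderiv ℝ φ z (0, 1) = 0 := by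
        rw [integral_const_mul, hφ.integral_fderiv_eq_zero, mul_zero]
      have hid : (fun z => |r z - 2| * fderiv ℝ φ z (1, 0)
            + entropyFlux V (r z) 2 * fderiv ℝ φ z (0, 1))
          = fun z => (2 * (max (k - r z) 0 * fderiv ℝ φ z (1, 0)
              + max (k - r z) 0 * (V * (1 - r z - k)) * fderiv ℝ φ z (0, 1))
            - (|r z - k| * fderiv ℝ φ z (1, 0) + entropyFlux V (r z) k * fderiv ℝ φ z (0, 1)))
            + ((2 - k) * fderiv ℝ φ z (1, 0)
              + -V * (2 + k * (1 - k)) * fderiv ℝ φ z (0, 1)) := by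
        funext z
        have a2 : |r z - 2| = 2 - r z := by
          rw [abs_of_neg (by linarith [(hr.mem_Icc z).2])]; ring
        have ak : |r z - k| = 2 * max (k - r z) 0 + (r z - k) := by
          rcases le_total (k - r z) 0 with hc | hc
          · rw [max_eq_right hc, abs_of_nonneg (by linarith)]; ring
          · rw [max_eq_left hc, abs_of_nonpos (by linarith)]; ring
        rw [entropyFlux, entropyFlux, a2, ak]
        ring
      have hdiff : Integrable fun z => 2 * (max (k - r z) 0 * fderiv ℝ φ z (1, 0)
            + max (k - r z) 0 * (V * (1 - r z - k)) * fderiv ℝ φ z (0, 1))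
          - (|r z - k| * fderiv ℝ φ z (1, 0) + entropyFlux V (r z) k * fderiv ℝ φ z (0, 1)) :=
        (hi12.const_mul 2).sub hi34
      rw [hid, integral_add hdiff hc12,
        integral_add hc1 hc2, hz1, hz2,
        integral_sub (hi12.const_mul 2) hi34, integral_const_mul] at e2
      linarith
    · intro η hη
      obtain ⟨d, hd, h⟩ := hrg η hη
      refine ⟨d, hd, ?_⟩
      filter_upwards [h] with t ht htd
      rw [zero_add]
      refine (lintegral_mono_ae ?_).trans (ht htd)
      filter_upwards [hkg] with x hx
      refine ENNReal.ofReal_le_ofReal (max_le ?_ (abs_nonneg _))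
      linarith [neg_abs_le (r (t, x) - g x)]
  filter_upwards [hpair.ae_eq_zero] with z hz
  have := le_max_left (k - r z) 0
  linarith

/-! ### Space translations and time dilations -/

theorem IsEntropyFunction.translate {V : ℝ} {r : ℝ × ℝ → ℝ} (hr : IsEntropyFunction V r) (h : ℝ) :
    IsEntropyFunction V fun z => r (z + (0, h)) := by
  have hrm := hr.measurable
  refine ⟨by fun_prop, fun z => hr.mem_Icc _, fun k φ hφ => ?_⟩
  have htest : IsNonnegTest fun z => φ (z - (0, h)) := by
    refine ⟨hφ.smooth.comp (by fun_prop), ?_, ?_, fun z => hφ.nonneg _⟩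
    · exact hφ.compact.comp_homeomorph (Homeomorph.subRight ((0 : ℝ), h))
    · have : tsupport (fun z => φ (z - (0, h))) ⊆ (fun z => z - (0, h)) ⁻¹' tsupport φ :=
        closure_minimal (fun z hz => subset_tsupport φ hz)
          ((isClosed_tsupport φ).preimage (by fun_prop))
      intro z hz
      have := hφ.support (this hz)
      simpa using this
  have hfd (z) : fderiv ℝ (fun z => φ (z - (0, h))) z = fderiv ℝ φ (z - (0, h)) :=
    fderiv_comp_sub _
  refine (hr.entropy k _ htest).trans_eq ?_
  rw [← integral_add_right_eq_self _ ((0 : ℝ), h)]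
  simp only [hfd, add_sub_cancel_right]

theorem HasInitialDatum.translate {g : ℝ → ℝ} {r : ℝ × ℝ → ℝ} (hr : HasInitialDatum g r) (h : ℝ) :
    HasInitialDatum (fun x => g (x + h)) fun z => r (z + (0, h)) := by
  intro η hη
  obtain ⟨d, hd, H⟩ := hr η hη
  refine ⟨d, hd, ?_⟩
  filter_upwards [H] with t ht htd
  have := lintegral_add_right_eq_self (μ := volume)
    (fun x => ENNReal.ofReal |r (t, x) - g x|) h
  simpa [this] using ht htd

theorem map_prodMk_mul_left {c : ℝ} (hc : 0 < c) :
    (volume : Measure (ℝ × ℝ)).map (fun z => (c * z.1, z.2)) = ENNReal.ofReal c⁻¹ • volume := by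
  have h := Measure.map_prod_map (volume : Measure ℝ) (volume : Measure ℝ)
    (measurable_const_mul c) measurable_id
  rw [Real.map_volume_mul_left hc.ne', Measure.map_id, abs_of_pos (inv_pos.mpr hc),
    Measure.prod_smul_left, ← Measure.volume_eq_prod] at h
  exact h.symm

/-- A linear change of time turns the flux `f_V` into `f_{cV}`. -/
theorem IsEntropyFunction.rescale {V c : ℝ} (hc : 0 < c) {r : ℝ × ℝ → ℝ}
    (hr : IsEntropyFunction V r) :
    IsEntropyFunction (c * V) fun z => r (c * z.1, z.2) := by
  have hrm := hr.measurable
  refine ⟨by fun_prop, fun z => hr.mem_Icc _, fun k φ hφ => ?_⟩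
  let S : (ℝ × ℝ) ≃L[ℝ] (ℝ × ℝ) :=
    (ContinuousLinearEquiv.unitsEquivAut ℝ (Units.mk0 c⁻¹ (inv_ne_zero hc.ne'))).prodCongr
      (ContinuousLinearEquiv.refl ℝ ℝ)
  have hS (z : ℝ × ℝ) : S z = (c⁻¹ * z.1, z.2) := by simp [S, mul_comm]
  have htest : IsNonnegTest fun z => φ (S z) := by
    refine ⟨hφ.smooth.comp S.contDiff, hφ.compact.comp_homeomorph S.toHomeomorph, ?_,
      fun z => hφ.nonneg _⟩
    have : tsupport (fun z => φ (S z)) ⊆ S ⁻¹' tsupport φ :=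
      closure_minimal (fun z hz => subset_tsupport φ hz)
        ((isClosed_tsupport φ).preimage S.continuous)
    intro z hz
    have h1 := hφ.support (this hz)
    rw [hS] at h1
    refine ⟨?_, trivial⟩
    have h2 : 0 < c⁻¹ * z.1 := h1.1
    exact (mul_pos_iff_of_pos_left (inv_pos.mpr hc)).mp h2
  have hfd (z v : ℝ × ℝ) : fderiv ℝ (fun z => φ (S z)) z v = fderiv ℝ φ (S z) (S v) := by
    have e : HasFDerivAt (fun z => φ (S z)) _ z :=
      ((hφ.smooth.differentiable (by simp) (S z)).hasFDerivAt).comp z S.hasFDerivAt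
    rw [e.fderiv]; simp
  have key := hr.entropy k _ htest
  have h1 (z : ℝ × ℝ) : fderiv ℝ φ z (S (1, 0)) = c⁻¹ * fderiv ℝ φ z (1, 0) := by
    rw [hS, show ((c⁻¹ * (1, (0 : ℝ)).1, (1, (0 : ℝ)).2) : ℝ × ℝ) = c⁻¹ • ((1 : ℝ), (0 : ℝ)) by simp,
      map_smul, smul_eq_mul]
  have h2 (z : ℝ × ℝ) : fderiv ℝ φ z (S (0, 1)) = fderiv ℝ φ z (0, 1) := by
    rw [hS]; simp
  simp only [hfd, h1, h2] at key
  have hm : Measurable fun z => |r z - k| * (c⁻¹ * fderiv ℝ φ (S z) (1, 0))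
      + entropyFlux V (r z) k * fderiv ℝ φ (S z) (0, 1) := by
    have m1 := measurable_entropyFlux V hrm (measurable_const (a := k))
    have m2 (v) : Measurable fun z => fderiv ℝ φ (S z) v :=
      ((hφ.continuous_fderiv_apply v).comp S.continuous).measurable
    have m3 := m2 (1, 0)
    have m4 := m2 (0, 1)
    fun_prop
  have hmap := integral_map (μ := (volume : Measure (ℝ × ℝ)))
    (φ := fun z : ℝ × ℝ => (c * z.1, z.2)) (by fun_prop) (hm.aestronglyMeasurable)
  rw [map_prodMk_mul_left hc, integral_smul_measure, ENNReal.toReal_ofReal (by positivity),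
    smul_eq_mul] at hmap
  have hSz (z : ℝ × ℝ) : S (c * z.1, z.2) = z := by
    rw [hS]; ext <;> simp [hc.ne']
  simp only [hSz] at hmap
  -- Pulling `φ` back by `S` multiplies its time derivative by `c⁻¹`. Since the entropy flux is
  -- linear in `V`, factoring out `c⁻¹` leaves the inequality with speed `c * V`.
  have : ∫ z : ℝ × ℝ, (|r (c * z.1, z.2) - k| * fderiv ℝ φ z (1, 0)
      + entropyFlux (c * V) (r (c * z.1, z.2)) k * fderiv ℝ φ z (0, 1))
      = c * ∫ z : ℝ × ℝ, (|r (c * z.1, z.2) - k| * (c⁻¹ * fderiv ℝ φ z (1, 0))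
      + entropyFlux V (r (c * z.1, z.2)) k * fderiv ℝ φ z (0, 1)) := by
    rw [← integral_const_mul]
    refine integral_congr_ae (Eventually.of_forall fun z => ?_)
    simp only [entropyFlux]
    field_simp
  rw [this, ← hmap]
  positivity

theorem ae_comp_mul_left {c : ℝ} (hc : c ≠ 0) {P : ℝ → Prop} (h : ∀ᵐ t, P t) :
    ∀ᵐ t, P (c * t) := by
  have hq : Measure.QuasiMeasurePreserving (c * ·) (volume : Measure ℝ) volume := by
    refine ⟨measurable_const_mul c, ?_⟩
    rw [Real.map_volume_mul_left hc]
    exact Measure.smul_absolutelyContinuous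
  exact hq.ae h

theorem HasInitialDatum.rescale {c : ℝ} (hc : 0 < c) {g : ℝ → ℝ} {r : ℝ × ℝ → ℝ}
    (hr : HasInitialDatum g r) : HasInitialDatum g fun z => r (c * z.1, z.2) := by
  intro η hη
  obtain ⟨d, hd, H⟩ := hr η hη
  refine ⟨d / c, by positivity, ?_⟩
  filter_upwards [ae_comp_mul_left hc.ne' H] with t ht htd
  refine ht ⟨mul_pos hc htd.1, ?_⟩
  have := htd.2
  rw [lt_div_iff₀ hc] at this
  linarith

/-! ### Bounded variation and approximation of the path -/

theorem BoundedVariationOn.measurable {g : ℝ → ℝ} (hg : BoundedVariationOn g univ) :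
    Measurable g := by
  obtain ⟨p, q, hp, hq, rfl⟩ :=
    hg.locallyBoundedVariationOn.exists_monotoneOn_sub_monotoneOn
  exact (monotoneOn_univ.mp hp).measurable.sub (monotoneOn_univ.mp hq).measurable

/-- The `L¹` modulus of continuity of a function of bounded variation. -/
theorem BoundedVariationOn.lintegral_translate_sub_le {g : ℝ → ℝ}
    (hg : BoundedVariationOn g univ) {h : ℝ} (hh : 0 ≤ h) :
    ∫⁻ x, ENNReal.ofReal |g (x + h) - g x|
      ≤ ENNReal.ofReal (h * (eVariationOn g univ).toReal) := by
  set W := (eVariationOn g univ).toReal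
  set v : ℝ → ℝ := variationOnFromTo g univ 0 with hv
  have hlbv := hg.locallyBoundedVariationOn
  have hmono : Monotone v := monotoneOn_univ.mp (variationOnFromTo.monotoneOn hlbv (mem_univ 0))
  have hsub (x y : ℝ) (hxy : x ≤ y) : v y - v x = variationOnFromTo g univ x y := by
    have := variationOnFromTo.add hlbv (mem_univ 0) (mem_univ x) (mem_univ y)
    simp only [hv]; linarith
  have hvW (x y : ℝ) (hxy : x ≤ y) : v y - v x ≤ W := by
    rw [hsub x y hxy, variationOnFromTo.eq_of_le _ _ hxy]
    exact ENNReal.toReal_mono hg (eVariationOn.mono _ (subset_univ _))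
  have hgv (x y : ℝ) (hxy : x ≤ y) : |g y - g x| ≤ v y - v x := by
    rw [hsub x y hxy, variationOnFromTo.eq_of_le _ _ hxy, ← Real.dist_eq]
    exact (hg.mono (subset_univ _)).dist_le ⟨mem_univ _, ⟨hxy, le_rfl⟩⟩ ⟨mem_univ _, ⟨le_rfl, hxy⟩⟩
  have hvi (a b : ℝ) : IntervalIntegrable v volume a b := hmono.intervalIntegrable
  have hvi' (c a b : ℝ) : IntervalIntegrable (fun x => v (x + c)) volume a b :=
    Monotone.intervalIntegrable fun x y hxy => hmono (by linarith)
  have hbound (n : ℕ) : ∫⁻ x in Ioc (-(n : ℝ)) n, ENNReal.ofReal |g (x + h) - g x|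
      ≤ ENNReal.ofReal (h * W) := by
    have hn : -(n : ℝ) ≤ n := by linarith [n.cast_nonneg (α := ℝ)]
    calc ∫⁻ x in Ioc (-(n : ℝ)) n, ENNReal.ofReal |g (x + h) - g x|
        ≤ ∫⁻ x in Ioc (-(n : ℝ)) n, ENNReal.ofReal (v (x + h) - v x) :=
          lintegral_mono fun x => ENNReal.ofReal_le_ofReal (hgv _ _ (by linarith))
      _ = ENNReal.ofReal (∫ x in (-(n : ℝ))..n, (v (x + h) - v x)) := by
          rw [intervalIntegral.integral_of_le hn, ofReal_integral_eq_lintegral_ofReal]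
          · exact ((hvi' h _ _).sub (hvi _ _)).1
          · exact Eventually.of_forall fun x => sub_nonneg.mpr (hmono (by linarith))
      _ ≤ ENNReal.ofReal (h * W) := by
          refine ENNReal.ofReal_le_ofReal ?_
          -- The integrals of `v` over the overlap of the two shifted intervals cancel. What remains
          -- is an interval of length `h` on which increments of the variation function are at most
          -- `W`.
          have e1 : ∫ x in (-(n : ℝ))..n, (v (x + h) - v x)
              = ∫ s in (0 : ℝ)..h, (v (s + n) - v (s + -n)) := by
            rw [intervalIntegral.integral_sub (hvi' h _ _) (hvi _ _),
              intervalIntegral.integral_comp_add_right,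
              intervalIntegral.integral_sub
                (hvi' n _ _) (hvi' (-n) _ _),
              intervalIntegral.integral_comp_add_right (fun x => v x) (n : ℝ),
              intervalIntegral.integral_comp_add_right (fun x => v x) (-(n : ℝ))]
            have a1 := intervalIntegral.integral_add_adjacent_intervals
              (hvi (-n) (-n + h)) (hvi (-n + h) (n + h))
            have a2 := intervalIntegral.integral_add_adjacent_intervals
              (hvi (-n) n) (hvi n (n + h))
            rw [zero_add, zero_add, add_comm h, add_comm h]
            linarith
          rw [e1]
          calc ∫ s in (0 : ℝ)..h, (v (s + n) - v (s + -n)) ≤ ∫ s in (0 : ℝ)..h, W := by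
                refine intervalIntegral.integral_mono_on hh ?_ (by simp)
                  fun s _ => hvW _ _ (by linarith)
                exact (hvi' n _ _).sub (hvi' (-n) _ _)
            _ = h * W := by simp
  have hgm := hg.measurable
  have hcov := (aecover_Ioc (μ := (volume : Measure ℝ))
    (tendsto_neg_atTop_atBot.comp (tendsto_natCast_atTop_atTop (R := ℝ)))
    (tendsto_natCast_atTop_atTop (R := ℝ))).lintegral_tendsto_of_nat
    (f := fun x => ENNReal.ofReal |g (x + h) - g x|) (by fun_prop)
  exact le_of_tendsto' hcov hbound

/-- Smooth approximation of a Lipschitz function which preserves lower bounds on the slope. -/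
theorem exists_contDiff_approx {P : ℝ → ℝ} {K : NNReal} (hP : LipschitzWith K P) {m : ℝ}
    (hm : ∀ s t, s ≤ t → m * (t - s) ≤ P t - P s) {ε : ℝ} (hε : 0 < ε) :
    ∃ q : ℝ → ℝ, ContDiff ℝ ∞ q ∧ (∀ t, m ≤ deriv q t) ∧ ∀ t, |q t - P t| ≤ ε := by
  -- Over a mollifier of this radius a `K`-Lipschitz function moves by at most `ε`; the `+ 1` covers
  -- `K = 0`.
  have hd : 0 < ε / (K + 1) := by positivity
  let η : ContDiffBump (0 : ℝ) := ⟨ε / (K + 1) / 2, ε / (K + 1), by positivity, by linarith⟩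
  let q : ℝ → ℝ := fun t => ∫ s, η.normed volume s * P (t - s)
  have hPc : Continuous P := hP.continuous
  have hηc : Continuous (η.normed volume) := η.continuous_normed
  have hint (t : ℝ) : Integrable fun s => η.normed volume s * P (t - s) :=
    (hηc.mul (by fun_prop)).integrable_of_hasCompactSupport η.hasCompactSupport_normed.mul_right
  have hqs : ContDiff ℝ ∞ q :=
    HasCompactSupport.contDiff_convolution_left (𝕜 := ℝ) (f := η.normed volume) (g := P)
      (μ := volume) (ContinuousLinearMap.lsmul ℝ ℝ) η.hasCompactSupport_normed η.contDiff_normed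
      hPc.locallyIntegrable
  refine ⟨q, hqs, fun t => ?_, fun t => ?_⟩
  -- An increment of `q` is an average of increments of `P` over translated intervals of the same
  -- length, so the lower slope bound survives.
  · have hmono : Monotone fun t => q t - m * t := by
      intro s t hst
      have h1 : q t - q s = ∫ u, η.normed volume u * (P (t - u) - P (s - u)) := by
        simp only [q]
        rw [← integral_sub (hint t) (hint s)]
        simp only [mul_sub]
      have h2 : ∫ u, η.normed volume u * (m * (t - s)) = m * (t - s) := by
        rw [integral_mul_const, η.integral_normed, one_mul]
      have h3 : m * (t - s) ≤ q t - q s := by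
        rw [h1]
        conv_lhs => rw [← h2]
        refine integral_mono (η.integrable_normed.mul_const _) ?_ fun u => ?_
        · refine ((hint t).sub (hint s)).congr (Eventually.of_forall fun u => ?_)
          simp [mul_sub]
        · refine mul_le_mul_of_nonneg_left ?_ (η.nonneg_normed u)
          have := hm (s - u) (t - u) (by linarith)
          rwa [sub_sub_sub_cancel_right] at this
      simp only
      linarith
    have hder : HasDerivAt (fun t => q t - m * t) (deriv q t - m * 1) t :=
      ((hqs.differentiable (by simp) t).hasDerivAt).sub ((hasDerivAt_id t).const_mul m)
    have := hmono.deriv_nonneg (x := t)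
    rw [hder.deriv] at this
    linarith
  · rw [← Real.dist_eq]
    refine η.dist_normed_convolution_le (μ := volume) (g := P) hPc.aestronglyMeasurable
      fun x hx => (hP.dist_le_mul x t).trans ?_
    have hx' : dist x t ≤ ε / (K + 1) := (Metric.mem_ball.mp hx).le
    calc (K : ℝ) * dist x t ≤ (K + 1) * (ε / (K + 1)) := by gcongr; linarith
      _ = ε := by field_simp

/-- A Lipschitz path on an interval extends to a Lipschitz path on the line with the same lower
bound on its slope. -/
theorem exists_lipschitzWith_extension {T : ℝ} (hT : 0 < T) {p : ℝ → ℝ} {K : NNReal}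
    (hp : LipschitzOnWith K p (Icc 0 T)) {m : ℝ}
    (hm : ∀ᵐ t ∂(volume.restrict (Icc 0 T)), m ≤ deriv p t) :
    ∃ (P : ℝ → ℝ) (K' : NNReal), LipschitzWith K' P ∧ EqOn P p (Icc 0 T) ∧
      ∀ s t, s ≤ t → m * (t - s) ≤ P t - P s := by
  have hslope (s t : ℝ) (hs : s ∈ Icc 0 T) (ht : t ∈ Icc 0 T) (hst : s ≤ t) :
      m * (t - s) ≤ p t - p s := by
    have hsub : uIcc s t ⊆ Icc 0 T := by
      rw [uIcc_of_le hst]; exact Icc_subset_Icc hs.1 ht.2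
    have hac := (hp.mono hsub).absolutelyContinuousOnInterval
    rw [← hac.integral_deriv_eq_sub]
    have e : m * (t - s) = ∫ _ in s..t, m := by simp [mul_comm]
    rw [e]
    refine intervalIntegral.integral_mono_ae_restrict hst (by simp)
      hac.intervalIntegrable_deriv ?_
    exact ae_restrict_of_ae_restrict_of_subset (uIcc_of_le hst ▸ hsub) hm
  -- Outside `[0, T]` the path is continued with slope exactly `m`.
  let c : ℝ → ℝ := fun t => projIcc 0 T hT.le t
  have hc (t) : c t ∈ Icc 0 T := (projIcc 0 T hT.le t).2
  have hcl : LipschitzWith 1 c := LipschitzWith.projIcc hT.le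
  have hcm : Monotone c := fun s t hst => monotone_projIcc hT.le hst
  have hpc : LipschitzWith (K * 1) (fun t => p (c t)) := by
    have := hp.comp hcl.lipschitzOnWith (s := univ) (fun t _ => hc t)
    exact lipschitzOnWith_univ.mp this
  have hid : LipschitzWith (‖m‖₊ * (1 + 1)) fun t => m * (t - c t) := by
    have h1 : LipschitzWith (1 + 1) fun t => t - c t := LipschitzWith.id.sub hcl
    have h2 : LipschitzWith ‖m‖₊ fun t : ℝ => m * t := by
      refine LipschitzWith.of_dist_le_mul fun x y => ?_
      rw [Real.dist_eq, Real.dist_eq, ← mul_sub, abs_mul]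
      rfl
    exact h2.comp h1
  refine ⟨fun t => p (c t) + m * (t - c t), _, hpc.add hid, fun t ht => ?_, fun s t hst => ?_⟩
  · have : c t = t := by simp only [c]; rw [projIcc_of_mem hT.le ht]
    simp [this]
  · have := hslope (c s) (c t) (hc s) (hc t) (hcm hst)
    simp only
    linarith

/-! ### Existence of traces along the path -/

/-- Concavity of the flux: between states above `k` the chord slope is at most the characteristic
speed at `k`. -/
theorem entropyFlux_le_of_le {V k a b : ℝ} (hV : 0 ≤ V) (ha : k ≤ a) (hb : k ≤ b) :
    entropyFlux V a b ≤ V * (1 - 2 * k) * |a - b| := by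
  rw [entropyFlux, mul_comm]
  refine mul_le_mul_of_nonneg_right (mul_le_mul_of_nonneg_left ?_ hV) (abs_nonneg _)
  linarith

/-- The `L¹` modulus of continuity in space of an entropy function, near a path which is faster than
all characteristics. -/
theorem IsEntropyFunction.lintegral_near_path_le {V k m δ T : ℝ} (hV : 0 ≤ V) (hδ : 0 < δ)
    {r : ℝ × ℝ → ℝ} (hr : IsEntropyFunction V r) (hk : ∀ z, k ≤ r z)
    {g : ℝ → ℝ} (hg : BoundedVariationOn g univ) (hrg : HasInitialDatum g r)
    (hVm : V * (1 - 2 * k) ≤ m - δ) {P : ℝ → ℝ} {K : NNReal} (hP : LipschitzWith K P)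
    (hm : ∀ s t, s ≤ t → m * (t - s) ≤ P t - P s) {h ε : ℝ} (hh : 0 ≤ h) (hε : 0 < ε) :
    ∫⁻ t in Ioo 0 T, ∫⁻ x in Ioo (P t - ε) (P t + ε),
        ENNReal.ofReal |r (t, x + h) - r (t, x)|
      ≤ ENNReal.ofReal (5 * Real.pi * ε / δ * (h * (eVariationOn g univ).toReal)) := by
  have hrm := hr.measurable
  have hgm := hg.measurable
  have hPm : Measurable P := hP.continuous.measurable
  -- The smooth curve stays within `ε` of `P`, so the `ε`-strip around `P` lies in the `2 * ε`-strip
  -- around `q`.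
  obtain ⟨q, hq, hq', hqP⟩ := exists_contDiff_approx hP hm hε
  have hpair := (hr.translate h).isDissipativePair hV (M := h * (eVariationOn g univ).toReal)
    (by positivity) hr (g := fun x => g (x + h)) (by fun_prop) hgm (hrg.translate h) hrg
    (hg.lintegral_translate_sub_le hh)
  let S : Set (ℝ × ℝ) := {z | z.1 ∈ Ioo 0 T ∧ z.2 ∈ Ioo (P z.1 - ε) (P z.1 + ε)}
  have hS : MeasurableSet S := by
    refine (measurable_fst measurableSet_Ioo).inter ?_
    exact (measurableSet_lt (by fun_prop) measurable_snd).inter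
      (measurableSet_lt measurable_snd (by fun_prop))
  obtain ⟨B₀, hB₀⟩ := (isCompact_Icc (a := (0 : ℝ)) (b := T)).exists_bound_of_continuousOn
    hP.continuous.continuousOn
  have key := hpair.setLIntegral_le (m := m) (ε := ε) (B := max T (B₀ + ε)) hδ hε
    (fun z => (entropyFlux_le_of_le hV (hk _) (hk _)).trans
      (mul_le_mul_of_nonneg_right hVm (abs_nonneg _))) hq hq' hS (by
      rintro ⟨t, x⟩ ⟨ht, hx⟩
      simp only [mem_Ioo] at ht hx
      have h1 := abs_le.mp (hB₀ t ⟨ht.1.le, ht.2.le⟩)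
      have h2 := abs_le.mp (hqP t)
      refine ⟨ht.1, ht.2.le.trans (le_max_left _ _), (abs_le.mpr ?_).trans (le_max_right _ _),
        abs_le.mpr ?_⟩ <;> constructor <;> linarith)
  refine le_of_eq_of_le ?_ key
  rw [← lintegral_indicator hS, Measure.volume_eq_prod, lintegral_prod _
    (Measurable.aemeasurable (Measurable.indicator (by fun_prop) hS)),
    ← lintegral_indicator measurableSet_Ioo]
  refine lintegral_congr fun t => ?_
  by_cases ht : t ∈ Ioo 0 T
  · rw [indicator_of_mem ht, ← lintegral_indicator measurableSet_Ioo]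
    refine lintegral_congr fun x => ?_
    by_cases hx : x ∈ Ioo (P t - ε) (P t + ε)
    · rw [indicator_of_mem hx, indicator_of_mem (show (t, x) ∈ S from ⟨ht, hx⟩)]
      simp
    · rw [indicator_of_notMem hx, indicator_of_notMem (fun hc : (t, x) ∈ S => hx hc.2)]
  · rw [indicator_of_notMem ht]
    symm
    rw [lintegral_eq_zero_iff' (Measurable.aemeasurable (by
      refine Measurable.comp (g := S.indicator _) (Measurable.indicator (by fun_prop) hS)
        measurable_prodMk_left))]
    exact Eventually.of_forall fun x => indicator_of_notMem (fun hc : (t, x) ∈ S => ht hc.1) _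

/-- The oscillation of a function between two Lebesgue points is bounded by difference quotients. -/
theorem ofReal_abs_sub_le_liminf {w : ℝ → ℝ} (hw : Measurable w) (hw1 : ∀ x, w x ∈ Icc (0 : ℝ) 1)
    {a b y y' : ℝ} (hyy : y ≤ y') (hy : y ∈ Ioo a b) (hy' : y' ∈ Ioo a b)
    (hd : HasDerivAt (fun x => ∫ s in (0 : ℝ)..x, w s) (w y) y)
    (hd' : HasDerivAt (fun x => ∫ s in (0 : ℝ)..x, w s) (w y') y') :
    ENNReal.ofReal |w y' - w y| ≤ liminf (fun n : ℕ => ENNReal.ofReal ((n : ℝ) + 1) *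
      ∫⁻ x in Ioo a b, ENNReal.ofReal |w (x + 1 / ((n : ℝ) + 1)) - w x|) atTop := by
  set W : ℝ → ℝ := fun x => ∫ s in (0 : ℝ)..x, w s with hW
  have hwi (c d : ℝ) : IntervalIntegrable w volume c d := by
    refine (intervalIntegrable_const (c := (1 : ℝ))).mono_fun hw.aestronglyMeasurable ?_
    refine Eventually.of_forall fun x => ?_
    simpa [abs_of_nonneg (hw1 x).1] using (hw1 x).2
  have hseq : Tendsto (fun n : ℕ => 1 / ((n : ℝ) + 1)) atTop (𝓝[≠] 0) :=
    tendsto_nhdsWithin_iff.mpr ⟨tendsto_one_div_add_atTop_nhds_zero_nat,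
      Eventually.of_forall fun n => by
        have : (0 : ℝ) < 1 / ((n : ℝ) + 1) := by positivity
        exact this.ne'⟩
  -- At both points `w` is the derivative of its primitive. The difference of the two quotients with
  -- step `h` equals `h⁻¹ ∫ (w (s + h) - w s)` over the interval between the points.
  have hlim := ((hasDerivAt_iff_tendsto_slope_zero.mp hd').comp hseq).sub
    ((hasDerivAt_iff_tendsto_slope_zero.mp hd).comp hseq)
  have hlim2 := ENNReal.tendsto_ofReal hlim.abs
  rw [← hlim2.liminf_eq]
  refine liminf_le_liminf (Eventually.of_forall fun n => ?_)
  simp only [Function.comp_apply, smul_eq_mul]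
  set h : ℝ := 1 / ((n : ℝ) + 1) with hh
  have hh0 : 0 < (n : ℝ) + 1 := by positivity
  have hinv : h⁻¹ = (n : ℝ) + 1 := by simp [hh]
  have hsub (c d : ℝ) : W d - W c = ∫ s in c..d, w s :=
    intervalIntegral.integral_interval_sub_left (hwi _ _) (hwi _ _)
  have hwi' : IntervalIntegrable (fun s => w (s + h)) volume y y' := by
    have := (hwi (y + h) (y' + h)).comp_add_right h
    simpa using this
  have key : (W (y' + h) - W y') - (W (y + h) - W y) = ∫ s in y..y', (w (s + h) - w s) := by
    rw [intervalIntegral.integral_sub hwi' (hwi _ _), intervalIntegral.integral_comp_add_right,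
      ← hsub, ← hsub]
    ring
  rw [← mul_sub, key, abs_mul, hinv, abs_of_pos hh0, ENNReal.ofReal_mul hh0.le]
  gcongr
  rw [intervalIntegral.integral_of_le hyy, ← Real.norm_eq_abs, ofReal_norm]
  refine (enorm_integral_le_lintegral_enorm _).trans ?_
  simp only [← ofReal_norm, Real.norm_eq_abs]
  exact lintegral_mono_set fun s hs => ⟨hy.1.trans hs.1, hs.2.trans_lt hy'.2⟩

theorem nhdsGT_inf_ae_neBot (x : ℝ) : (𝓝[>] x ⊓ ae (volume : Measure ℝ)).NeBot := by
  rw [inf_neBot_iff]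
  intro s hs t ht
  by_contra hcon
  rw [not_nonempty_iff_eq_empty] at hcon
  obtain ⟨u, hu, hus⟩ := mem_nhdsGT_iff_exists_Ioo_subset.mp hs
  have h0 : volume (Ioo x u) = 0 := by
    refine measure_mono_null (t := tᶜ) (fun y hy hyt => ?_) (mem_ae_iff.mp ht)
    have : y ∈ s ∩ t := ⟨hus hy, hyt⟩
    rw [hcon] at this
    exact this
  rw [Real.volume_Ioo, ENNReal.ofReal_eq_zero] at h0
  have : x < u := hu
  linarith

theorem nhdsGT_inf_ae_le (x : ℝ) :
    𝓝[>] x ⊓ ae (volume : Measure ℝ) ≤ 𝓝 x ⊓ ae (volume : Measure ℝ) :=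
  inf_le_inf_right _ nhdsWithin_le_nhds

/-- A measurable function whose essential oscillation near `x₀` is controlled has an essential limit
at `x₀`. -/
theorem exists_tendsto_nhds_inf_ae {w : ℝ → ℝ} (hw : Measurable w)
    (hw1 : ∀ x, w x ∈ Icc (0 : ℝ) 1) {x₀ : ℝ}
    (h : ∀ η : ENNReal, 0 < η → ∃ ε > 0, liminf (fun n : ℕ => ENNReal.ofReal ((n : ℝ) + 1) *
      ∫⁻ x in Ioo (x₀ - ε) (x₀ + ε), ENNReal.ofReal |w (x + 1 / ((n : ℝ) + 1)) - w x|) atTop < η) :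
    ∃ L, Tendsto w (𝓝 x₀ ⊓ ae volume) (𝓝 L) := by
  have : (𝓝 x₀ ⊓ ae (volume : Measure ℝ)).NeBot := (nhdsGT_inf_ae_neBot x₀).mono (nhdsGT_inf_ae_le x₀)
  have hloc : LocallyIntegrable w volume := by
    refine (locallyIntegrable_const (1 : ℝ)).mono hw.aestronglyMeasurable
      (Eventually.of_forall fun x => ?_)
    rw [Real.norm_of_nonneg (hw1 x).1]; simpa using (hw1 x).2
  have hleb := LocallyIntegrable.ae_hasDerivAt_integral hloc
  have hcauchy : Cauchy (map w (𝓝 x₀ ⊓ ae volume)) := by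
    rw [Metric.cauchy_iff]
    refine ⟨inferInstance, fun η hη => ?_⟩
    obtain ⟨ε, hε, hlt⟩ := h (ENNReal.ofReal η) (ENNReal.ofReal_pos.mpr hη)
    -- Almost every point of the window is a differentiability point of the primitive, and any two
    -- such values differ by less than `η`: the image filter is Cauchy.
    let G : Set ℝ := Ioo (x₀ - ε) (x₀ + ε) ∩
      {y | ∀ c, HasDerivAt (fun x => ∫ s in c..x, w s) (w y) y}
    refine ⟨w '' G, image_mem_map (inter_mem_inf
      (Ioo_mem_nhds (by linarith) (by linarith)) hleb), ?_⟩
    rintro _ ⟨y, hy, rfl⟩ _ ⟨y', hy', rfl⟩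
    rw [Real.dist_eq]
    rcases le_total y y' with hyy | hyy
    · have := (ofReal_abs_sub_le_liminf hw hw1 hyy hy.1 hy'.1 (hy.2 0) (hy'.2 0)).trans_lt hlt
      rw [abs_sub_comm]
      exact (ENNReal.ofReal_lt_ofReal_iff hη).mp this
    · have := (ofReal_abs_sub_le_liminf hw hw1 hyy hy'.1 hy.1 (hy'.2 0) (hy.2 0)).trans_lt hlt
      exact (ENNReal.ofReal_lt_ofReal_iff hη).mp this
  exact CompleteSpace.complete hcauchy

/-- Existence of the two-sided trace of an entropy function along a path which is faster than all
characteristics. -/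
theorem IsEntropyFunction.ae_exists_tendsto {V k m δ T : ℝ} (hV : 0 ≤ V) (hδ : 0 < δ)
    {r : ℝ × ℝ → ℝ} (hr : IsEntropyFunction V r) (hk : ∀ z, k ≤ r z)
    {g : ℝ → ℝ} (hg : BoundedVariationOn g univ) (hrg : HasInitialDatum g r)
    (hVm : V * (1 - 2 * k) ≤ m - δ) {P : ℝ → ℝ} {K : NNReal} (hP : LipschitzWith K P)
    (hm : ∀ s t, s ≤ t → m * (t - s) ≤ P t - P s) :
    ∀ᵐ t ∂(volume.restrict (Ioo 0 T)),
      ∃ L, Tendsto (fun x => r (t, x)) (𝓝 (P t) ⊓ ae volume) (𝓝 L) := by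
  have hrm := hr.measurable
  have hPm : Measurable P := hP.continuous.measurable
  let F : ℝ → ℕ → ℝ → ENNReal := fun ε n t => ENNReal.ofReal ((n : ℝ) + 1) *
    ∫⁻ x in Ioo (P t - ε) (P t + ε), ENNReal.ofReal |r (t, x + 1 / ((n : ℝ) + 1)) - r (t, x)|
  have hFm (ε : ℝ) (n : ℕ) : Measurable (F ε n) := by
    refine Measurable.const_mul ?_ _
    have hSm : MeasurableSet {z : ℝ × ℝ | z.2 ∈ Ioo (P z.1 - ε) (P z.1 + ε)} :=
      (measurableSet_lt (by fun_prop) measurable_snd).inter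
        (measurableSet_lt measurable_snd (by fun_prop))
    have h1 : Measurable ({z : ℝ × ℝ | z.2 ∈ Ioo (P z.1 - ε) (P z.1 + ε)}.indicator fun z =>
        ENNReal.ofReal |r (z.1, z.2 + 1 / ((n : ℝ) + 1)) - r (z.1, z.2)|) :=
      Measurable.indicator (by fun_prop) hSm
    convert h1.lintegral_prod_right' (ν := (volume : Measure ℝ)) using 2 with t
    rw [← lintegral_indicator measurableSet_Ioo]
    rfl
  let A : ℝ → ℝ → ENNReal := fun ε t => liminf (fun n => F ε n t) atTop
  have hAm (ε : ℝ) : Measurable (A ε) := Measurable.liminf (hFm ε)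
  -- The factor `n + 1` cancels the step `h = 1 / (n + 1)`, so the strip estimate becomes linear in
  -- `ε` uniformly in `n`, and Fatou passes it to the liminf.
  set C : ℝ := 5 * Real.pi / δ * (eVariationOn g univ).toReal with hC
  have hC0 : 0 ≤ C := by have := Real.pi_pos; positivity
  have hAint (ε : ℝ) (hε : 0 < ε) : ∫⁻ t in Ioo 0 T, A ε t ≤ ENNReal.ofReal (C * ε) := by
    refine (lintegral_liminf_le (hFm ε)).trans ?_
    refine liminf_le_of_frequently_le' (Frequently.of_forall fun n => ?_)
    have hn : (0 : ℝ) < (n : ℝ) + 1 := by positivity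
    have hb := hr.lintegral_near_path_le (T := T) hV hδ hk hg hrg hVm hP hm
      (h := 1 / ((n : ℝ) + 1)) (by positivity) hε
    simp only [F]
    rw [lintegral_const_mul' _ _ ENNReal.ofReal_ne_top]
    calc _ ≤ ENNReal.ofReal ((n : ℝ) + 1) * ENNReal.ofReal
          (5 * Real.pi * ε / δ * (1 / ((n : ℝ) + 1) * (eVariationOn g univ).toReal)) := by gcongr
      _ = ENNReal.ofReal (C * ε) := by
        rw [← ENNReal.ofReal_mul hn.le]
        congr 1
        rw [hC]
        field_simp
  -- The infimum over windows has zero integral, so at a.e. time some window has oscillation below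
  -- any given `η`.
  have hinf : ∫⁻ t in Ioo 0 T, ⨅ j : ℕ, A (1 / ((j : ℝ) + 1)) t = 0 := by
    refine le_antisymm ?_ zero_le
    have hlim : Tendsto (fun j : ℕ => ENNReal.ofReal (C * (1 / ((j : ℝ) + 1)))) atTop (𝓝 0) := by
      have := ENNReal.tendsto_ofReal
        ((tendsto_one_div_add_atTop_nhds_zero_nat (𝕜 := ℝ)).const_mul C)
      simpa using this
    refine ge_of_tendsto' hlim fun j => ?_
    exact (lintegral_mono fun t => iInf_le _ j).trans (hAint _ (by positivity))
  rw [lintegral_eq_zero_iff (Measurable.iInf fun j => hAm _)] at hinf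
  filter_upwards [hinf] with t ht
  refine exists_tendsto_nhds_inf_ae (by fun_prop) (fun x => hr.mem_Icc _) fun η hη => ?_
  have : ⨅ j : ℕ, A (1 / ((j : ℝ) + 1)) t < η := by
    rw [ht]; exact hη
  obtain ⟨j, hj⟩ := iInf_lt_iff.mp this
  exact ⟨1 / ((j : ℝ) + 1), by positivity, hj⟩

/-! ### Dependence of the traces on time and on dilations -/

theorem rightTrace_eq {u : ℝ → ℝ} {x L : ℝ} (h : Tendsto u (𝓝 x ⊓ ae volume) (𝓝 L)) :
    rightTrace u x = L := by
  have := nhdsGT_inf_ae_neBot x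
  exact (h.mono_left (nhdsGT_inf_ae_le x)).limUnder_eq

theorem tendsto_nhds_inf_ae_congr {u w : ℝ → ℝ} (huw : u =ᵐ[volume] w) {x L : ℝ}
    (h : Tendsto w (𝓝 x ⊓ ae volume) (𝓝 L)) : Tendsto u (𝓝 x ⊓ ae volume) (𝓝 L) :=
  h.congr' ((huw.symm : w =ᶠ[ae volume] u).filter_mono inf_le_right)

/-- Essential limits at nearby points converge to the essential limit at a point. -/
theorem tendsto_of_tendsto_nhds_inf_ae {ι : Type*} {l : Filter ι} {w : ℝ → ℝ} {x₀ L : ℝ}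
    (h : Tendsto w (𝓝 x₀ ⊓ ae volume) (𝓝 L)) {x M : ι → ℝ} (hx : Tendsto x l (𝓝 x₀))
    (hM : ∀ᶠ i in l, Tendsto w (𝓝 (x i) ⊓ ae volume) (𝓝 (M i))) : Tendsto M l (𝓝 L) := by
  rw [Metric.tendsto_nhds]
  intro η hη
  have hev := h.eventually (Metric.closedBall_mem_nhds L (half_pos hη))
  obtain ⟨U, hU, A, hA, hUA⟩ := mem_inf_iff_superset.mp hev
  obtain ⟨O, hOU, hO, hxO⟩ := mem_nhds_iff.mp hU
  filter_upwards [hM, hx.eventually (hO.mem_nhds hxO)] with i hi hiO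
  have : (𝓝 (x i) ⊓ ae (volume : Measure ℝ)).NeBot :=
    (nhdsGT_inf_ae_neBot (x i)).mono (nhdsGT_inf_ae_le (x i))
  have hmem : M i ∈ Metric.closedBall L (η / 2) := by
    refine Metric.isClosed_closedBall.mem_of_tendsto hi ?_
    exact mem_of_superset (inter_mem_inf (hO.mem_nhds hiO) hA)
      fun y hy => hUA ⟨hOU hy.1, hy.2⟩
  exact (Metric.mem_closedBall.mp hmem).trans_lt (half_lt_self hη)

/-- The essential limits along a continuous path depend measurably on time. -/
theorem exists_measurable_essLimit {r : ℝ × ℝ → ℝ} (hrm : Measurable r)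
    (hr1 : ∀ z, r z ∈ Icc (0 : ℝ) 1) {P : ℝ → ℝ} (hP : Continuous P) {S : Set ℝ}
    (h : ∀ᵐ t ∂(volume.restrict S),
      ∃ L, Tendsto (fun x => r (t, x)) (𝓝 (P t) ⊓ ae volume) (𝓝 L)) :
    ∃ f : ℝ → ℝ, Measurable f ∧ (∀ t, f t ∈ Icc (0 : ℝ) 1) ∧ ∀ᵐ t ∂(volume.restrict S),
      Tendsto (fun x => r (t, x)) (𝓝 (P t) ⊓ ae volume) (𝓝 (f t)) := by
  have hPm : Measurable P := hP.measurable
  -- Averages over short intervals to the right of the path are measurable in `t` and converge to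
  -- the essential limit wherever it exists. The limsup, clamped to `[0, 1]`, is then a measurable
  -- choice.
  let A : ℕ → ℝ → ℝ := fun n t =>
    ((n : ℝ) + 1) * ∫ y in (0 : ℝ)..(1 / ((n : ℝ) + 1)), r (t, y + P t)
  have hA (n : ℕ) : Measurable (A n) := by
    refine Measurable.const_mul ?_ _
    simp only [intervalIntegral.integral_of_le (show (0 : ℝ) ≤ 1 / ((n : ℝ) + 1) by positivity)]
    have h1 : Measurable fun z : ℝ × ℝ => r (z.1, z.2 + P z.1) := by fun_prop
    exact (h1.stronglyMeasurable.integral_prod_right'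
      (ν := volume.restrict (Ioc (0 : ℝ) (1 / ((n : ℝ) + 1))))).measurable
  let f : ℝ → ℝ := fun t => max 0 (min 1 (limsup (fun n => A n t) atTop))
  have hf : Measurable f := by
    have : Measurable fun t => limsup (fun n => A n t) atTop := Measurable.limsup hA
    fun_prop
  refine ⟨f, hf, fun t => ⟨le_max_left _ _, max_le zero_le_one (min_le_left _ _)⟩, ?_⟩
  filter_upwards [h] with t ⟨L, hL⟩
  have hNB : (𝓝 (P t) ⊓ ae (volume : Measure ℝ)).NeBot :=
    (nhdsGT_inf_ae_neBot (P t)).mono (nhdsGT_inf_ae_le (P t))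
  have hLmem : L ∈ Icc (0 : ℝ) 1 :=
    isClosed_Icc.mem_of_tendsto hL (Eventually.of_forall fun x => hr1 _)
  have hwm : Measurable fun x => r (t, x) := by fun_prop
  have hwi (c d : ℝ) : IntervalIntegrable (fun x => r (t, x)) volume c d := by
    refine (intervalIntegrable_const (c := (1 : ℝ))).mono_fun hwm.aestronglyMeasurable ?_
    refine Eventually.of_forall fun x => ?_
    simpa [abs_of_nonneg (hr1 (t, x)).1] using (hr1 (t, x)).2
  have hd : HasDerivAt (fun u => ∫ x in (0 : ℝ)..u, r (t, x)) L (P t) :=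
    (intervalIntegral.integral_hasStrictDerivAt_of_tendsto_ae_right (hwi 0 (P t))
      (hwm.stronglyMeasurable.stronglyMeasurableAtFilter) hL).hasDerivAt
  have hseq : Tendsto (fun n : ℕ => 1 / ((n : ℝ) + 1)) atTop (𝓝[≠] 0) :=
    tendsto_nhdsWithin_iff.mpr ⟨tendsto_one_div_add_atTop_nhds_zero_nat,
      Eventually.of_forall fun n => by
        have : (0 : ℝ) < 1 / ((n : ℝ) + 1) := by positivity
        exact this.ne'⟩
  have hlim := (hasDerivAt_iff_tendsto_slope_zero.mp hd).comp hseq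
  have hAL : Tendsto (fun n => A n t) atTop (𝓝 L) := by
    refine hlim.congr fun n => ?_
    simp only [Function.comp_apply, smul_eq_mul, A]
    rw [intervalIntegral.integral_interval_sub_left (hwi _ _) (hwi _ _),
      intervalIntegral.integral_comp_add_right (fun x => r (t, x)), zero_add, add_comm (P t)]
    simp
  have hfL : f t = L := by
    simp only [f]
    rw [hAL.limsup_eq, min_eq_right hLmem.2, max_eq_right hLmem.1]
  rw [hfL]
  exact hL

/-- `L¹`-continuity of the essential limits along a path under dilations of time. -/
theorem tendsto_lintegral_essLimit_sub {r : ℝ × ℝ → ℝ} {P : ℝ → ℝ} (hP : Continuous P) {T : ℝ}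
    (hT : 0 < T) {f : ℝ → ℝ} (hf : Measurable f) (hf1 : ∀ t, f t ∈ Icc (0 : ℝ) 1)
    (hlim : ∀ᵐ t ∂(volume.restrict (Ioo 0 T)),
      Tendsto (fun x => r (t, x)) (𝓝 (P t) ⊓ ae volume) (𝓝 (f t)))
    {c : ℕ → ℝ} (hc0 : ∀ n, 0 < c n) (hc : Tendsto c atTop (𝓝 1)) {φ : ℕ → ℝ → ℝ}
    (hφ : ∀ n, Measurable (φ n)) (hφ1 : ∀ n t, φ n t ∈ Icc (0 : ℝ) 1)
    (hφlim : ∀ n, ∀ᵐ t ∂(volume.restrict (Ioo 0 T)),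
      Tendsto (fun x => r (c n * t, x)) (𝓝 (P t) ⊓ ae volume) (𝓝 (φ n t))) :
    Tendsto (fun n => ∫⁻ t in Ioo 0 T, ‖φ n t - f t‖ₑ) atTop (𝓝 0) := by
  set F : ℝ → ℝ := (Ioo 0 T).indicator f with hF
  have hFm : Measurable F := hf.indicator measurableSet_Ioo
  have hF1 (t) : F t ∈ Icc (0 : ℝ) 1 := by
    by_cases ht : t ∈ Ioo 0 T
    · rw [hF, indicator_of_mem ht]; exact hf1 t
    · rw [hF, indicator_of_notMem ht]; exact ⟨le_rfl, zero_le_one⟩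
  have hFi : Integrable F := by
    rw [hF, integrable_indicator_iff measurableSet_Ioo]
    refine Measure.integrableOn_of_bounded (M := 1) (by simp) hf.aestronglyMeasurable
      (Eventually.of_forall fun t => ?_)
    rw [Real.norm_of_nonneg (hf1 t).1]; exact (hf1 t).2
  have hcinv : Tendsto (fun n => (c n)⁻¹) atTop (𝓝 1) := by simpa using hc.inv₀ one_ne_zero
  have hc2 : ∀ᶠ n in atTop, (c n)⁻¹ < 2 := hcinv.eventually (gt_mem_nhds (by norm_num))
  have hmap (n) : (volume : Measure ℝ).map (c n * ·) = ENNReal.ofReal (c n)⁻¹ • volume := by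
    rw [Real.map_volume_mul_left (hc0 n).ne', abs_of_pos (inv_pos.mpr (hc0 n))]
  have hdil : Tendsto (fun n => ∫⁻ t in Ioo 0 T, ‖F (c n * t) - F t‖ₑ) atTop (𝓝 0) := by
    refine tendsto_setLIntegral_comp_sub (T := fun n t => c n * t) hFi hFm (by simp)
      (Eventually.of_forall fun n => by fun_prop) (fun t => ?_) (C := 2) (by simp) ?_
    · simpa using hc.mul_const t
    · filter_upwards [hc2] with n hn
      rw [hmap n]
      gcongr
      exact ENNReal.ofReal_le_of_le_toReal (by simpa using hn.le)
  -- In the variable `s = c n * t` both terms refer to the same slice `r (s, ·)`: one is its limit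
  -- at `P (s / c n)`, the other its limit at `P s`.
  let G : ℕ → ℝ → ENNReal := fun n s =>
    (Ioo 0 (c n * T)).indicator (fun s => ‖φ n ((c n)⁻¹ * s) - F s‖ₑ) s
  have hGm (n) : Measurable (G n) := by
    have := hφ n
    exact Measurable.indicator (by fun_prop) measurableSet_Ioo
  have hG1 (n s) : G n s ≤ (Ioo 0 (c n * T)).indicator 1 s := by
    refine indicator_le_indicator ?_
    rw [← ofReal_norm, Pi.one_apply, ← ENNReal.ofReal_one]
    refine ENNReal.ofReal_le_ofReal ?_
    rw [Real.norm_eq_abs, abs_le]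
    constructor <;> linarith [(hφ1 n ((c n)⁻¹ * s)).1, (hφ1 n ((c n)⁻¹ * s)).2, (hF1 s).1,
      (hF1 s).2]
  have hcT : ∀ᶠ n in atTop, c n * T < 2 * T := by
    filter_upwards [hc.eventually (gt_mem_nhds (show (1 : ℝ) < 2 by norm_num))] with n hn
    gcongr
  have hGlim : Tendsto (fun n => ∫⁻ s, G n s) atTop (𝓝 0) := by
    have := tendsto_lintegral_filter_of_dominated_convergence (μ := (volume : Measure ℝ))
      (l := atTop) (F := G) (f := fun _ => 0) ((Ioo 0 (2 * T)).indicator 1)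
      (Eventually.of_forall hGm) (by
        filter_upwards [hcT] with n hn
        refine Eventually.of_forall fun s => (hG1 n s).trans ?_
        exact indicator_le_indicator_of_subset (Ioo_subset_Ioo_right hn.le)
          (fun _ => zero_le) s)
      (by rw [lintegral_indicator_one measurableSet_Ioo]; exact measure_Ioo_lt_top.ne)
      (by
        have h1 : ∀ᵐ s : ℝ, ∀ n, (c n)⁻¹ * s ∈ Ioo 0 T →
            Tendsto (fun x => r (s, x)) (𝓝 (P ((c n)⁻¹ * s)) ⊓ ae volume)
              (𝓝 (φ n ((c n)⁻¹ * s))) := by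
          refine ae_all_iff.mpr fun n => ?_
          have := ae_comp_mul_left (inv_ne_zero (hc0 n).ne')
            ((ae_restrict_iff' measurableSet_Ioo).mp (hφlim n))
          filter_upwards [this] with s hs hsI
          have := hs hsI
          rwa [mul_inv_cancel_left₀ (hc0 n).ne'] at this
        filter_upwards [h1, (ae_restrict_iff' measurableSet_Ioo).mp hlim,
          (measure_eq_zero_iff_ae_notMem.mp (measure_singleton T) : ∀ᵐ s : ℝ, s ∉ ({T} : Set ℝ))]
          with s hs1 hs2 hsT
        have hscale : Tendsto (fun n => (c n)⁻¹ * s) atTop (𝓝 s) := by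
          simpa using hcinv.mul_const s
        have hzero_of (hev : ∀ᶠ n in atTop, s ∉ Ioo 0 (c n * T)) :
            Tendsto (fun n => G n s) atTop (𝓝 0) := by
          refine tendsto_const_nhds.congr' ?_
          filter_upwards [hev] with n hn
          simp only [G]
          rw [indicator_of_notMem hn]
        rcases le_or_gt s 0 with hs0 | hs0
        · exact hzero_of (Eventually.of_forall fun n hn => absurd hn.1 (not_lt.mpr hs0))
        -- At `s = T` membership in `Ioo 0 (c n * T)` need not stabilise; this single time is
        -- discarded as a null set.
        rcases lt_trichotomy s T with hlt | heq | hgt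
        · have hmem : ∀ᶠ n in atTop, (c n)⁻¹ * s ∈ Ioo 0 T :=
            hscale.eventually (Ioo_mem_nhds hs0 hlt)
          have hconv : Tendsto (fun n => φ n ((c n)⁻¹ * s)) atTop (𝓝 (f s)) :=
            tendsto_of_tendsto_nhds_inf_ae (hs2 ⟨hs0, hlt⟩) ((hP.tendsto s).comp hscale)
              (hmem.mono fun n hn => hs1 n hn)
          have hFs : F s = f s := indicator_of_mem (show s ∈ Ioo 0 T from ⟨hs0, hlt⟩) _
          have hz : Tendsto (fun n => ‖φ n ((c n)⁻¹ * s) - F s‖ₑ) atTop (𝓝 0) := by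
            rw [hFs]
            simpa using (hconv.sub_const (f s)).enorm
          refine tendsto_of_tendsto_of_tendsto_of_le_of_le tendsto_const_nhds hz
            (fun _ => zero_le) fun n => ?_
          exact indicator_le_self _ _ s
        · exact absurd heq hsT
        · refine hzero_of ?_
          have : Tendsto (fun n => c n * T) atTop (𝓝 T) := by simpa using hc.mul_const T
          filter_upwards [this.eventually (gt_mem_nhds hgt)] with n hn hcon
          exact absurd hcon.2 (not_lt.mpr hn.le))
    simpa using this
  have hfirst (n) (hn : (c n)⁻¹ < 2) :
      ∫⁻ t in Ioo 0 T, ‖φ n t - F (c n * t)‖ₑ ≤ 2 * ∫⁻ s, G n s := by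
    calc ∫⁻ t in Ioo 0 T, ‖φ n t - F (c n * t)‖ₑ ≤ ∫⁻ t, G n (c n * t) := by
          rw [← lintegral_indicator measurableSet_Ioo]
          refine lintegral_mono fun t => ?_
          by_cases ht : t ∈ Ioo 0 T
          · have hm : c n * t ∈ Ioo 0 (c n * T) :=
              ⟨mul_pos (hc0 n) ht.1, mul_lt_mul_of_pos_left ht.2 (hc0 n)⟩
            simp only [G]
            rw [indicator_of_mem ht, indicator_of_mem hm, inv_mul_cancel_left₀ (hc0 n).ne']
          · rw [indicator_of_notMem ht]; exact zero_le
      _ = ∫⁻ s, G n s ∂((volume : Measure ℝ).map (c n * ·)) :=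
          (lintegral_map (hGm n) (measurable_const_mul _)).symm
      _ = ENNReal.ofReal (c n)⁻¹ * ∫⁻ s, G n s := by
          rw [hmap n, lintegral_smul_measure, smul_eq_mul]
      _ ≤ 2 * ∫⁻ s, G n s := by
          gcongr
          exact ENNReal.ofReal_le_of_le_toReal (by simpa using hn.le)
  have hsum : Tendsto (fun n => (2 * ∫⁻ s, G n s) + ∫⁻ t in Ioo 0 T, ‖F (c n * t) - F t‖ₑ) atTop
      (𝓝 0) := by
    simpa using (ENNReal.Tendsto.const_mul hGlim (Or.inr (ENNReal.ofNat_ne_top (n := 2)))).add hdil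
  refine tendsto_of_tendsto_of_tendsto_of_le_of_le' tendsto_const_nhds hsum
    (Eventually.of_forall fun _ => zero_le) ?_
  filter_upwards [hc2] with n hn
  have hφn := hφ n
  calc ∫⁻ t in Ioo 0 T, ‖φ n t - f t‖ₑ
      ≤ ∫⁻ t in Ioo 0 T, (‖φ n t - F (c n * t)‖ₑ + ‖F (c n * t) - F t‖ₑ) := by
        refine setLIntegral_mono' measurableSet_Ioo fun t ht => ?_
        have e : φ n t - f t = (φ n t - F (c n * t)) + (F (c n * t) - F t) := by
          rw [show F t = f t from indicator_of_mem ht _]; ring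
        rw [e]
        exact enorm_add_le _ _
    _ = (∫⁻ t in Ioo 0 T, ‖φ n t - F (c n * t)‖ₑ) + ∫⁻ t in Ioo 0 T, ‖F (c n * t) - F t‖ₑ :=
        lintegral_add_left (by fun_prop) _
    _ ≤ _ := by gcongr; exact hfirst n hn

/-! ### Continuity of the error functional -/

/-- Replacing `r` by `max k r` changes it only on a null set of positive times and yields the
everywhere bound under which the flux is compared pointwise with the speed of the path. -/
theorem IsKruzkovSolution.exists_isEntropyFunction_ge {V : ℝ} (hV : 0 ≤ V) {ρo g : ℝ → ℝ}
    {ρ : ℝ → ℝ → ℝ} (h : IsKruzkovSolution (lwrFlux V) ρo ρ) (hg : ρo =ᵐ[volume] g)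
    {k : ℝ} (hk : k ∈ Icc (0 : ℝ) 1) (hkg : ∀ᵐ x, k ≤ g x) :
    ∃ r, IsEntropyFunction V r ∧ HasInitialDatum g r ∧ (∀ z, k ≤ r z) ∧
      ∀ᵐ z ∂(volume.restrict (Ioi (0 : ℝ) ×ˢ (univ : Set ℝ))), ρ z.1 z.2 = r z := by
  obtain ⟨r, hr, hrg, hρr⟩ := h.exists_isEntropyFunction hg
  have hge := hr.ae_le hV hrg hk hkg
  have hae : ∀ᵐ z ∂(volume.restrict (Ioi (0 : ℝ) ×ˢ (univ : Set ℝ))), max k (r z) = r z := by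
    filter_upwards [hge] with z hz using max_eq_right hz
  have hrm := hr.measurable
  refine ⟨fun z => max k (r z), hr.congr (by fun_prop) (fun z => ?_) hae, hrg.congr hae,
    fun z => le_max_left _ _, ?_⟩
  · exact ⟨hk.1.trans (le_max_left _ _), max_le hk.2 (hr.mem_Icc z).2⟩
  · filter_upwards [hρr, hae] with z h1 h2
    rw [h1, h2]

theorem abs_deriv_le_of_lipschitzOnWith {T : ℝ} {p : ℝ → ℝ} {K : NNReal}
    (hp : LipschitzOnWith K p (Icc 0 T)) :
    ∀ᵐ t ∂(volume.restrict (Icc 0 T)), |deriv p t| ≤ K := by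
  rw [← Measure.restrict_congr_set (Ioo_ae_eq_Icc (μ := volume) (a := (0 : ℝ)) (b := T))]
  filter_upwards [ae_restrict_mem measurableSet_Ioo] with t ht
  exact norm_deriv_le_of_lipschitzOn (Icc_mem_nhds ht.1 ht.2) hp

theorem intervalIntegrable_abs_deriv_sub {T : ℝ} (hT : 0 ≤ T) {p : ℝ → ℝ} {K : NNReal}
    (hp : LipschitzOnWith K p (Icc 0 T)) (V : ℝ) {f : ℝ → ℝ} (hf : Measurable f)
    (hf1 : ∀ t, f t ∈ Icc (0 : ℝ) 1) :
    IntervalIntegrable (fun t => |deriv p t - lwrSpeed V (f t)|) volume 0 T := by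
  rw [intervalIntegrable_iff_integrableOn_Icc_of_le hT]
  have hm := measurable_deriv p
  refine Measure.integrableOn_of_bounded (M := K + |V|) (by simp)
    (Measurable.aestronglyMeasurable (by unfold lwrSpeed; fun_prop)) ?_
  filter_upwards [abs_deriv_le_of_lipschitzOnWith hp] with t ht
  rw [Real.norm_eq_abs, abs_abs]
  refine (abs_sub _ _).trans (add_le_add ht ?_)
  rw [lwrSpeed, abs_mul]
  refine mul_le_of_le_one_right (abs_nonneg _) ?_
  rw [abs_le]; constructor <;> linarith [(hf1 t).1, (hf1 t).2]

/-- Continuity of the error integral in the speed parameter and in the trace. -/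
theorem tendsto_integral_abs_deriv_sub {T : ℝ} (hT : 0 ≤ T) {p : ℝ → ℝ} {K : NNReal}
    (hp : LipschitzOnWith K p (Icc 0 T)) {W : ℕ → ℝ} {V : ℝ} (hW : Tendsto W atTop (𝓝 V))
    {f : ℝ → ℝ} (hf : Measurable f) (hf1 : ∀ t, f t ∈ Icc (0 : ℝ) 1) {φ : ℕ → ℝ → ℝ}
    (hφ : ∀ n, Measurable (φ n)) (hφ1 : ∀ n t, φ n t ∈ Icc (0 : ℝ) 1)
    (hlim : Tendsto (fun n => ∫⁻ t in Ioo 0 T, ‖φ n t - f t‖ₑ) atTop (𝓝 0)) :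
    Tendsto (fun n => ∫ t in (0 : ℝ)..T, |deriv p t - lwrSpeed (W n) (φ n t)|) atTop
      (𝓝 (∫ t in (0 : ℝ)..T, |deriv p t - lwrSpeed V (f t)|)) := by
  rw [tendsto_iff_edist_tendsto_0]
  have hbound (n) : edist (∫ t in (0 : ℝ)..T, |deriv p t - lwrSpeed (W n) (φ n t)|)
      (∫ t in (0 : ℝ)..T, |deriv p t - lwrSpeed V (f t)|)
      ≤ ‖W n - V‖ₑ * ENNReal.ofReal T + ‖V‖ₑ * ∫⁻ t in Ioo 0 T, ‖φ n t - f t‖ₑ := by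
    have hφn := hφ n
    rw [edist_eq_enorm_sub, ← intervalIntegral.integral_sub
      (intervalIntegrable_abs_deriv_sub hT hp _ (hφ n) (hφ1 n))
      (intervalIntegrable_abs_deriv_sub hT hp _ hf hf1), intervalIntegral.integral_of_le hT,
      integral_Ioc_eq_integral_Ioo]
    refine (enorm_integral_le_lintegral_enorm _).trans ?_
    calc _ ≤ ∫⁻ t in Ioo 0 T, (‖W n - V‖ₑ + ‖V‖ₑ * ‖φ n t - f t‖ₑ) := by
          refine lintegral_mono fun t => ?_
          simp only [← ofReal_norm]
          rw [← ENNReal.ofReal_mul (norm_nonneg _),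
            ← ENNReal.ofReal_add (norm_nonneg _) (by positivity)]
          refine ENNReal.ofReal_le_ofReal ?_
          simp only [Real.norm_eq_abs]
          refine (abs_abs_sub_abs_le _ _).trans ?_
          have e : deriv p t - lwrSpeed (W n) (φ n t) - (deriv p t - lwrSpeed V (f t))
              = -((W n - V) * (1 - φ n t)) + V * (φ n t - f t) := by
            simp only [lwrSpeed]; ring
          rw [e]
          refine (abs_add_le _ _).trans ?_
          rw [abs_neg, abs_mul, abs_mul]
          gcongr
          refine mul_le_of_le_one_right (abs_nonneg _) ?_
          rw [abs_le]; constructor <;> linarith [(hφ1 n t).1, (hφ1 n t).2]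
      _ = _ := by
          rw [lintegral_add_left measurable_const, lintegral_const_mul _ (by fun_prop)]
          simp
  have hz : Tendsto (fun n => ‖W n - V‖ₑ * ENNReal.ofReal T
      + ‖V‖ₑ * ∫⁻ t in Ioo 0 T, ‖φ n t - f t‖ₑ) atTop (𝓝 0) := by
    have h1 : Tendsto (fun n => ‖W n - V‖ₑ) atTop (𝓝 0) := by
      simpa using (hW.sub_const V).enorm
    have h2 := ENNReal.Tendsto.mul_const h1 (Or.inr (ENNReal.ofReal_ne_top (r := T)))
    have h3 := ENNReal.Tendsto.const_mul hlim (Or.inr (enorm_ne_top (x := V)))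
    simpa using h2.add h3
  exact tendsto_of_tendsto_of_tendsto_of_le_of_le tendsto_const_nhds hz (fun _ => zero_le) hbound

theorem proposition2p2
    (T Vmin Vmax rmin : ℝ) (hT : 0 < T) (hVmin : 0 < Vmin) (hV : Vmin < Vmax)
    (hrmin : rmin ∈ Ioo (0 : ℝ) 1)
    -- the initial datum: values in `[0,1]`, finite total variation
    (ρo : ℝ → ℝ) (hρo : ∀ᵐ x ∂(volume : Measure ℝ), ρo x ∈ Icc (0 : ℝ) 1) (hBV : HasFiniteTV ρo)
    -- the path: `W^{1,∞}([0,T])`, i.e. Lipschitz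
    (p : ℝ → ℝ) (hp : ∃ K, LipschitzOnWith K p (Icc 0 T))
    (hinf : rmin < essInf ρo volume)
    (hpV : Vmax * (1 - 2 * rmin) ≤ essInf (deriv p) (volume.restrict (Icc 0 T)))
    -- implied by the previous line if `rmin ≤ 1 / 2`, and by `0 ≤ deriv p` if `1 / 2 ≤ rmin`
    (hpV' : Vmin * (1 - 2 * rmin) ≤ essInf (deriv p) (volume.restrict (Icc 0 T)))
    -- `ρ V` is the solution for the speed law `lwrSpeed V`
    (ρ : ℝ → ℝ → ℝ → ℝ)
    (hρ : ∀ V ∈ Icc Vmin Vmax, IsKruzkovSolution (lwrFlux V) ρo (ρ V)) :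
    -- the functional is well defined: for a.e. `t`, the two-sided essential limit of
    -- `ρ V t` at `p t` exists (so it is also the right trace), and the error is integrable
    (∀ V ∈ Icc Vmin Vmax,
      (∀ᵐ t ∂(volume.restrict (Icc 0 T)),
        Tendsto (ρ V t) (𝓝 (p t) ⊓ ae volume) (𝓝 (rightTrace (ρ V t) (p t)))) ∧
      IntervalIntegrable (speedError p V (ρ V)) volume 0 T) ∧
    ContinuousOn (fun V => errorFunctional T p V (ρ V)) (Icc Vmin Vmax) ∧
    ∃ V₀ ∈ Icc Vmin Vmax, ∀ V ∈ Icc Vmin Vmax,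
      errorFunctional T p V₀ (ρ V₀) ≤ errorFunctional T p V (ρ V) := by
  obtain ⟨g, hg, hgBV⟩ := hBV
  obtain ⟨K, hpK⟩ := hp
  set k := essInf ρo volume with hkdef
  set m := essInf (deriv p) (volume.restrict (Icc 0 T)) with hmdef
  -- Boundedness from below makes the real-valued `essInf` a genuine essential lower bound.
  have hkρ : ∀ᵐ x, k ≤ ρo x :=
    ae_essInf_le ⟨0, eventually_map.mpr (hρo.mono fun x hx => hx.1)⟩
  have hk : k ∈ Icc (0 : ℝ) 1 := by
    obtain ⟨x, hx1, hx2⟩ := (hkρ.and hρo).exists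
    exact ⟨(hrmin.1.trans hinf).le, hx1.trans hx2.2⟩
  have hkg : ∀ᵐ x, k ≤ g x := by
    filter_upwards [hkρ, hg] with x h1 h2
    rwa [← h2]
  have hm : ∀ᵐ t ∂(volume.restrict (Icc 0 T)), m ≤ deriv p t :=
    ae_essInf_le ⟨-K, eventually_map.mpr
      ((abs_deriv_le_of_lipschitzOnWith hpK).mono fun t ht => (abs_le.mp ht).1)⟩
  obtain ⟨P, K', hP, hPp, hslope⟩ := exists_lipschitzWith_extension hT hpK hm
  -- This is the smallest value over `V` of `V (1 - 2 rmin) - V (1 - 2 k)`, the margin gained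
  -- because `k` exceeds `rmin`.
  set δ : ℝ := 2 * Vmin * (k - rmin) with hδdef
  have hδ : 0 < δ := by
    have := sub_pos.mpr hinf
    positivity
  have hspeed (V) (hVI : V ∈ Icc Vmin Vmax) : V * (1 - 2 * k) ≤ m - δ := by
    -- The left side is linear in `V`, so the two endpoint hypotheses suffice; the sign of `1 - 2 *
    -- rmin` decides which one applies.
    have h1 : V * (1 - 2 * rmin) ≤ m := by
      rcases le_total 0 (1 - 2 * rmin) with h | h
      · exact (mul_le_mul_of_nonneg_right hVI.2 h).trans hpV
      · exact (mul_le_mul_of_nonpos_right hVI.1 h).trans hpV'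
    have h2 : Vmin * (k - rmin) ≤ V * (k - rmin) :=
      mul_le_mul_of_nonneg_right hVI.1 (sub_pos.mpr hinf).le
    rw [hδdef]
    linarith
  have hV0 (V) (hVI : V ∈ Icc Vmin Vmax) : 0 < V := hVmin.trans_le hVI.1
  -- representatives of the solutions and of their traces
  have hrep (V) (hVI : V ∈ Icc Vmin Vmax) : ∃ (r : ℝ × ℝ → ℝ) (f : ℝ → ℝ),
      IsEntropyFunction V r ∧ HasInitialDatum g r ∧
      (∀ᵐ z ∂(volume.restrict (Ioi (0 : ℝ) ×ˢ (univ : Set ℝ))), ρ V z.1 z.2 = r z) ∧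
      Measurable f ∧ (∀ t, f t ∈ Icc (0 : ℝ) 1) ∧
      ∀ᵐ t ∂(volume.restrict (Ioo 0 T)),
        Tendsto (fun x => r (t, x)) (𝓝 (P t) ⊓ ae volume) (𝓝 (f t)) := by
    obtain ⟨r, hr, hrg, hkr, hρr⟩ :=
      (hρ V hVI).exists_isEntropyFunction_ge (hV0 V hVI).le hg hk hkg
    obtain ⟨f, hf, hf1, hflim⟩ := exists_measurable_essLimit hr.measurable hr.mem_Icc hP.continuous
      (hr.ae_exists_tendsto (T := T) (hV0 V hVI).le hδ hkr hgBV hrg (hspeed V hVI) hP hslope)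
    exact ⟨r, f, hr, hrg, hρr, hf, hf1, hflim⟩
  choose! r f hr hrg hρr hf hf1 hflim using hrep
  have htrace (V) (hVI : V ∈ Icc Vmin Vmax) : ∀ᵐ t ∂(volume.restrict (Icc 0 T)),
      Tendsto (ρ V t) (𝓝 (p t) ⊓ ae volume) (𝓝 (f V t)) := by
    rw [← Measure.restrict_congr_set (Ioo_ae_eq_Icc (μ := volume) (a := (0 : ℝ)) (b := T))]
    filter_upwards [hflim V hVI, ae_restrict_of_ae (ae_ae_of_ae_halfPlane (hρr V hVI)),
      ae_restrict_mem measurableSet_Ioo] with t h1 h2 ht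
    rw [hPp ⟨ht.1.le, ht.2.le⟩] at h1
    exact tendsto_nhds_inf_ae_congr (h2 ht.1) h1
  have herr (V) (hVI : V ∈ Icc Vmin Vmax) : ∀ᵐ t ∂(volume.restrict (Icc 0 T)),
      |deriv p t - lwrSpeed V (f V t)| = speedError p V (ρ V) t := by
    filter_upwards [htrace V hVI] with t ht
    rw [speedError, rightTrace_eq ht]
  have hE (V) (hVI : V ∈ Icc Vmin Vmax) : errorFunctional T p V (ρ V)
      = ∫ t in (0 : ℝ)..T, |deriv p t - lwrSpeed V (f V t)| := by
    rw [errorFunctional, intervalIntegral.integral_of_le hT.le,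
      intervalIntegral.integral_of_le hT.le]
    refine integral_congr_ae ?_
    filter_upwards [ae_restrict_of_ae_restrict_of_subset Ioc_subset_Icc_self (herr V hVI)] with t ht
    exact ht.symm
  have hcont : ContinuousOn (fun V => errorFunctional T p V (ρ V)) (Icc Vmin Vmax) := by
    intro V hVI
    refine tendsto_of_seq_tendsto fun W hW => ?_
    obtain ⟨hWV, hWI⟩ := tendsto_nhdsWithin_iff.mp hW
    -- a sequence with values in the parameter interval and with the same tail
    let W' : ℕ → ℝ := fun n => max Vmin (min Vmax (W n))
    have hW'I (n) : W' n ∈ Icc Vmin Vmax := ⟨le_max_left _ _, max_le hV.le (min_le_left _ _)⟩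
    have hWW' : W' =ᶠ[atTop] W := by
      filter_upwards [hWI] with n hn
      simp only [W']
      rw [min_eq_right hn.2, max_eq_right hn.1]
    have hW'V : Tendsto W' atTop (𝓝 V) := hWV.congr' hWW'.symm
    have hVpos := hV0 V hVI
    have hc0 (n) : 0 < W' n / V := div_pos (hV0 _ (hW'I n)) hVpos
    have hc : Tendsto (fun n => W' n / V) atTop (𝓝 1) := by
      simpa [div_self hVpos.ne'] using hW'V.div_const V
    -- Dilating time by `W' n / V` turns `r V` into an entropy function with speed `W' n` and the
    -- same datum. By uniqueness it agrees with `r (W' n)` a.e., so both have the same essential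
    -- limits along the path.
    have hφlim (n) : ∀ᵐ t ∂(volume.restrict (Ioo 0 T)),
        Tendsto (fun x => r V (W' n / V * t, x)) (𝓝 (P t) ⊓ ae volume) (𝓝 (f (W' n) t)) := by
      have hs := (hr V hVI).rescale (hc0 n)
      rw [div_mul_cancel₀ _ hVpos.ne'] at hs
      have huniq := hs.ae_eq (hV0 _ (hW'I n)).le (hr _ (hW'I n)) hgBV.measurable
        ((hrg V hVI).rescale (hc0 n)) (hrg _ (hW'I n))
      filter_upwards [hflim _ (hW'I n), ae_restrict_of_ae (ae_ae_of_ae_halfPlane huniq),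
        ae_restrict_mem measurableSet_Ioo] with t h1 h2 ht
      exact tendsto_nhds_inf_ae_congr (h2 ht.1) h1
    have hL1 := tendsto_lintegral_essLimit_sub (r := r V) hP.continuous hT (hf V hVI) (hf1 V hVI)
      (hflim V hVI) hc0 hc (fun n => hf _ (hW'I n)) (fun n => hf1 _ (hW'I n)) hφlim
    have hlim := tendsto_integral_abs_deriv_sub hT.le hpK hW'V (hf V hVI) (hf1 V hVI)
      (fun n => hf _ (hW'I n)) (fun n => hf1 _ (hW'I n)) hL1
    rw [← hE V hVI] at hlim
    refine hlim.congr' ?_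
    filter_upwards [hWW'] with n hn
    rw [← hE _ (hW'I n), hn]
    rfl
  refine ⟨fun V hVI => ⟨?_, ?_⟩, hcont, ?_⟩
  · filter_upwards [htrace V hVI] with t ht
    rwa [rightTrace_eq ht]
  · refine (intervalIntegrable_abs_deriv_sub hT.le hpK V (hf V hVI) (hf1 V hVI)).congr_ae ?_
    rw [uIoc_of_le hT.le]
    exact ae_restrict_of_ae_restrict_of_subset Ioc_subset_Icc_self (herr V hVI)
  · exact isCompact_Icc.exists_isMinOn (nonempty_Icc.mpr hV.le) hcont
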